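/- **Definitions.** An *orbisphere group* with orders $\mathrm{ord}_1,\dots,\mathrm{ord}_n\in\{2,3,\dots,\infty\}$ ($n\ge 2$) is a group $G$ with conjugacy classes $\Gamma_1,\dots,\Gamma_n$ (the *peripheral classes*) such that, for some $\gamma_i\in\Gamma_i$, $$G=\langle \gamma_1,\dots,\gamma_n\mid \gamma_i^{\mathrm{ord}_i}\ (\mathrm{ord}_i<\infty),\ \gamma_1\cdots\gamma_n\rangle .$$ Its Euler characteristic is $2-\sum_{i=1}^n(1-1/\mathrm{ord}_i)$, with $1/\infty=0$. A *$G$-$G$-biset* is a set $B$ with commuting left and right actions of $G$. If the left action is free with finitely many orbits, then for $g\in G$ the *lift* of $g$ is the multiset of pairs $(d,h^G)$, one for each cycle of the permutation of $G\backslash B$ induced by right multiplication by $g$, where $d$ is the length of the cycle and $h\in G$ is given by $hs=sg^d$ for a representative $s\in B$ of a point of the cycle; it depends only on the conjugacy class of $g$. A non-empty $G$-$G$-biset $B$ is an *orbisphere biset* if 1. its left action is free with a finite number $d$ of orbits, and its right action is transitive; 2. for suitable $g_i\in\Gamma_i$, the permutations $\sigma_i$ of $G\backslash B$ induced by right multiplication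 by $g_i$ form an admissible tuple: $\sigma_1\cdots\sigma_n=1$ (permutations acting on the right), the $\sigma_i$ generate a transitive group, and $\sum_{i}\sum_{c\text{ cycle of }\sigma_i}(\mathrm{length}(c)-1)=2d-2$; 3. the multiset of conjugacy classes of all lifts of $\Gamma_1,\dots,\Gamma_n$ contains every $\Gamma_j$ exactly once, all its other members being the trivial class. A *self-conjugacy* of $B$ is a pair $(\varphi,\beta)$ of an automorphism $\varphi$ of the group $G$ and a bijection $\beta\colon B\to B$ with $\beta(hbg)=\varphi(h)\beta(b)\varphi(g)$ for all $h,g\in G$, $b\in B$. An *automorphism* of $B$ is a self-conjugacy with $\varphi=\mathrm{id}$. **Theorem (No automorphisms).** Let $G$ be a non-cyclic orbisphere group of non-positive Euler characteristic, and let ${}_GB_G$ be an orbisphere biset. Then the automorphism group of $B$ is trivial. Hence every self-conjugacy of $B$ is determined by its group map: if $(\varphi,\beta)$ and $(\varphi,\beta')$ are self-conjugacies of $B$, then $\beta=\beta'$. -/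

import Mathlib

open scoped RightActions

/-! ### Orbisphere groups -/

/-- The relators `γᵢ ^ ord i` (for those `i` with `ord i` finite) and `γ₁ γ₂ ⋯ γₙ`
of the standard presentation of an orbisphere group. -/
def orbisphereRels {n : ℕ} (ord : Fin n → ℕ∞) : Set (FreeGroup (Fin n)) :=
  {w | ∃ (i : Fin n) (k : ℕ), ord i = (k : ℕ∞) ∧ w = FreeGroup.of i ^ k} ∪
    {(List.ofFn fun i : Fin n => FreeGroup.of i).prod}

/-- `(G, Γ₁, …, Γₙ)` is an orbisphere group with orders `ord i ∈ {2, 3, …, ∞}`: it has the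
presentation `⟨γ₁, …, γₙ | γ₁ ^ ord 1, …, γₙ ^ ord n, γ₁ ⋯ γₙ⟩` for some choice of
`γᵢ ∈ Γᵢ`.  The `Γᵢ` are the peripheral conjugacy classes. -/
structure IsOrbisphereGroup (G : Type*) [Group G] {n : ℕ} (ord : Fin n → ℕ∞)
    (Γ : Fin n → ConjClasses G) : Prop where
  two_le_card : 2 ≤ n
  two_le_ord : ∀ i, 2 ≤ ord i
  presentation : ∃ e : PresentedGroup (orbisphereRels ord) ≃* G,
    ∀ i, ConjClasses.mk (e (PresentedGroup.of i)) = Γ i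

/-- The orbifold Euler characteristic `2 - ∑ᵢ (1 - 1 / ord i)`, where `1 / ∞ = 0`
(here `ENat.toNat ⊤ = 0` and `0⁻¹ = 0`). -/
def orbisphereEulerChar {n : ℕ} (ord : Fin n → ℕ∞) : ℚ :=
  2 - ∑ i, (1 - ((ord i).toNat : ℚ)⁻¹)

/-! ### Bisets

An `H`-`G`-biset is a type `B` with a left action of `H`, a right action of `G`
(an action of `Gᵐᵒᵖ`, written `b <• g`), and `SMulCommClass H Gᵐᵒᵖ B`. -/

/-- The set `{·} ⊗_H B = H \ B` of left `H`-orbits in `B`. -/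
abbrev LeftOrbits (H B : Type*) [Group H] [MulAction H B] : Type _ :=
  MulAction.orbitRel.Quotient H B

/-- The permutation `[b] ↦ [b g]` of `H \ B` induced by the right action of `g`. -/
def rightPerm (H : Type*) {G B : Type*} [Group H] [Group G] [MulAction H B] [MulAction Gᵐᵒᵖ B]
    [SMulCommClass H Gᵐᵒᵖ B] (g : G) : Equiv.Perm (LeftOrbits H B) :=
  Quotient.congr (MulAction.toPerm (MulOpposite.op g)) (by
    intro a b
    change a ∈ MulAction.orbit H b ↔ a <• g ∈ MulAction.orbit H (b <• g)
    constructor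
    · rintro ⟨h, rfl⟩
      exact ⟨h, smul_comm h (MulOpposite.op g) b⟩
    · rintro ⟨h, hh⟩
      refine ⟨h, ?_⟩
      have h1 : (h • b) <• g = a <• g := by
        rw [← hh]
        exact (smul_comm h (MulOpposite.op g) b).symm
      exact MulAction.injective (MulOpposite.op g) h1)

theorem rightPerm_mk (H : Type*) {G B : Type*} [Group H] [Group G] [MulAction H B]
    [MulAction Gᵐᵒᵖ B] [SMulCommClass H Gᵐᵒᵖ B] (g : G) (b : B) :
    rightPerm H g (Quotient.mk _ b : LeftOrbits H B) = Quotient.mk _ (b <• g) :=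
  rfl

/-- The cycles of a permutation of `X`, fixed points included. -/
abbrev PermCycles {X : Type*} (σ : Equiv.Perm X) : Type _ :=
  Quotient (Equiv.Perm.SameCycle.setoid σ)

open scoped Classical in
/-- An admissible tuple of permutations of a finite set of cardinality `d`.
Permutations act on the right in the mathematical convention, so that `σ₁ ⋯ σₙ` means
"first `σ₁`, then `σ₂`, …"; hence the reversal of the list.  In the Riemann-Hurwitz formula
`∑ᵢ ∑_c (length c - 1) = 2 d - 2` the cycles of length one do not contribute, and they are
not listed in `Equiv.Perm.cycleType`. -/
structure IsAdmissibleTuple {X : Type*} [Fintype X] {n : ℕ} (σ : Fin n → Equiv.Perm X) :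
    Prop where
  prod_eq_one : (List.ofFn σ).reverse.prod = 1
  transitive : MulAction.IsPretransitive (Subgroup.closure (Set.range σ)) X
  riemann_hurwitz :
    (∑ i, ((σ i).cycleType.map fun l => l - 1).sum) + 2 = 2 * Fintype.card X

/-- `(d, C)` is the lift of `g` attached to the cycle `c` of `g` on `H \ B`: the cycle has
length `d`, and `C` is the conjugacy class of the `h` with `h s = s g ^ d`, where `s ∈ B` is
a representative of a point of `c`. -/
def IsLift {H G B : Type*} [Group H] [Group G] [MulAction H B] [MulAction Gᵐᵒᵖ B]
    [SMulCommClass H Gᵐᵒᵖ B] (g : G) (c : PermCycles (rightPerm (B := B) H g))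
    (d : ℕ) (C : ConjClasses H) : Prop :=
  ∃ (s : B) (h : H), Quotient.mk _ (Quotient.mk _ s : LeftOrbits H B) = c ∧
    d = Function.minimalPeriod (rightPerm H g) (Quotient.mk _ s : LeftOrbits H B) ∧
    h • s = s <• (g ^ d) ∧ ConjClasses.mk h = C

/-- An orbisphere `H`-`G`-biset, with respect to the peripheral classes `Δⱼ` of `H` and
`Γᵢ` of `G`: it is left-free of finite degree and right-transitive; representatives of the
`Γᵢ` act on `H \ B` by an admissible tuple; and the multiset of all lifts of
`Γ₁, …, Γₙ` consists of every `Δⱼ` exactly once (the lifts along the cycles `ι j`)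
and otherwise of trivial conjugacy classes. -/
structure IsOrbisphereBiset (H G B : Type*) [Group H] [Group G] [MulAction H B]
    [MulAction Gᵐᵒᵖ B] [SMulCommClass H Gᵐᵒᵖ B] {m n : ℕ}
    (Δ : Fin m → ConjClasses H) (Γ : Fin n → ConjClasses G) : Prop where
  left_free : ∀ (h : H) (b : B), h • b = b → h = 1
  finite_degree : Finite (LeftOrbits H B)
  nonempty : Nonempty B
  right_transitive : ∀ b b' : B, ∃ g : G, b <• g = b'
  admissible_and_lifts : ∃ γ : Fin n → G, (∀ i, ConjClasses.mk (γ i) = Γ i) ∧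
    (letI := Fintype.ofFinite (LeftOrbits H B)
     IsAdmissibleTuple fun i => rightPerm (B := B) H (γ i)) ∧
    ∃ ι : Fin m ↪ (Σ i : Fin n, PermCycles (rightPerm (B := B) H (γ i))),
      (∀ j, ∃ d, IsLift (γ (ι j).1) (ι j).2 d (Δ j)) ∧
      ∀ c, c ∉ Set.range ι → ∃ d, IsLift (γ c.1) c.2 d (ConjClasses.mk 1)

/-! ### Self-conjugacies and automorphisms -/

/-- A self-conjugacy of a `G`-`G`-biset `B`: a group automorphism `φ` of `G` and a bijection
`β` of `B` with `β (h b g) = φ h (β b) φ g`. -/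
def IsSelfConjugacy {G B : Type*} [Group G] [MulAction G B] [MulAction Gᵐᵒᵖ B]
    (φ : G ≃* G) (β : Equiv.Perm B) : Prop :=
  ∀ (h : G) (b : B) (g : G), β (h • b <• g) = φ h • β b <• φ g

/-- The automorphism group of a `G`-`G`-biset `B`: the self-conjugacies with `φ = 1`. -/
def bisetAut (G B : Type*) [Group G] [MulAction G B] [MulAction Gᵐᵒᵖ B] :
    Subgroup (Equiv.Perm B) where
  carrier := {β | IsSelfConjugacy (MulEquiv.refl G) β}
  one_mem' := fun _ _ _ => rfl
  mul_mem' := by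
    intro α β hα hβ h b g
    change α (β (h • b <• g)) = h • α (β b) <• g
    rw [hβ h b g]
    exact hα h (β b) g
  inv_mem' := by
    intro β hβ h b g
    change β⁻¹ (h • b <• g) = h • β⁻¹ b <• g
    apply β.injective
    have key := hβ h (β⁻¹ b) g
    change β (h • β⁻¹ b <• g) = h • β (β⁻¹ b) <• g at key
    have hb : ∀ x, β (β⁻¹ x) = x := fun x => β.apply_symm_apply x
    rw [hb] at key ⊢
    exact key.symm

/-! An automorphism `β` permutes the left orbits of `B`, commutes with every `rightPerm`, and
carries cycles to cycles with the same lift. Each peripheral class occurs exactly once among the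
lifts. Hence, if these classes are distinct and non-trivial, `β` preserves the `n` cycles that carry
them; here `n ≥ 3`, since `n = 2` gives a cyclic group. A non-trivial rotation of finite order of
the sphere has only two fixed points. The combinatorial counterpart is
`eq_one_of_commute_admissible`, which plays the Riemann-Hurwitz equality for `B` against Ree's
inequality `sum_card_permCycles_le` on the quotient by `⟨β⟩`. So `β` fixes every left orbit, `β b =
z • b`, and compatibility with both actions makes `z` central. A trivial center then gives `β = 1`.

It remains to show that, for Euler characteristic at most zero, the peripheral classes are distinct
and non-trivial and the center is trivial. By `γ i ↦ s i * s (i + 1)` the group embeds in the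
reflection group of a polygon (`orbisphereToCoxeter_injective`), which is studied in its geometric
representation; the main tool there is the dichotomy between positive and negative roots
(`geometricRep_nonneg`, `geometricRep_nonpos`). A central element acts diagonally, and determinant
and signs of roots force it to be trivial. Peripheral classes are separated by killing one generator
when `n ≥ 4`, and by traces and abelian quotients when `n = 3`. -/

/-! ### The geometric representation of a Coxeter group -/

section GeometricRepresentation

open Module CoxeterSystem

variable {ι : Type*} [Fintype ι] [DecidableEq ι]

/-- The functional `v ↦ 2 B(α_i, v)` on `ι → ℝ`, where `B` is the bilinear form with
Gram matrix `b` in the standard basis `α`. -/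
def simpleCoroot (b : ι → ι → ℝ) (i : ι) : Dual ℝ (ι → ℝ) :=
  ∑ j, (2 * b i j) • LinearMap.proj j

theorem simpleCoroot_single (b : ι → ι → ℝ) (i j : ι) :
    simpleCoroot b i (Pi.single j 1) = 2 * b i j := by
  simp [simpleCoroot, Pi.single_apply]

/-- The reflection `v ↦ v - 2 B(α_i, v) α_i`. -/
noncomputable def simpleReflection (b : ι → ι → ℝ) (i : ι) (h : b i i = 1) :
    (ι → ℝ) ≃ₗ[ℝ] (ι → ℝ) :=
  reflection (x := Pi.single i 1) (f := simpleCoroot b i) (by simp [simpleCoroot_single, h])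

variable {b : ι → ι → ℝ}

theorem simpleReflection_apply {i : ι} (h : b i i = 1) (v : ι → ℝ) :
    simpleReflection b i h v = v - simpleCoroot b i v • Pi.single i 1 :=
  reflection_apply _ _

theorem simpleReflection_single {i : ι} (h : b i i = 1) (j : ι) :
    simpleReflection b i h (Pi.single j 1) = Pi.single j 1 - (2 * b i j) • Pi.single i 1 := by
  rw [simpleReflection_apply, simpleCoroot_single]

theorem simpleReflection_mul_self {i : ι} (h : b i i = 1) :
    simpleReflection b i h * simpleReflection b i h = 1 := by
  ext1 v
  exact involutive_reflection _ v

/-- The sequence `0, 1, c, c ^ 2 - 1, …` with `u (k + 2) = c u (k + 1) - u k`. -/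
def dihedralSeq (c : ℝ) : ℕ → ℝ
  | 0 => 0
  | 1 => 1
  | k + 2 => c * dihedralSeq c (k + 1) - dihedralSeq c k

theorem dihedralSeq_add_two (c : ℝ) (k : ℕ) :
    dihedralSeq c (k + 2) = c * dihedralSeq c (k + 1) - dihedralSeq c k := rfl

/-- The sequence consists of Chebyshev polynomials of the second kind, with `c = 2 cos θ`. -/
theorem dihedralSeq_mul_sin (θ : ℝ) (k : ℕ) :
    dihedralSeq (2 * Real.cos θ) k * Real.sin θ = Real.sin (k * θ) := by
  induction k using Nat.twoStepInduction with
  | zero => simp [dihedralSeq]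
  | one => simp [dihedralSeq]
  | more k h1 h2 =>
    have h3 : Real.sin ((k + 2 : ℝ) * θ) = 2 * Real.cos θ * Real.sin ((k + 1 : ℝ) * θ)
        - Real.sin (k * θ) := by
      rw [show (k + 2 : ℝ) * θ = (k + 1 : ℝ) * θ + θ by ring,
        show (k : ℝ) * θ = (k + 1 : ℝ) * θ - θ by ring, Real.sin_add, Real.sin_sub]
      ring
    push_cast at h2 ⊢
    rw [dihedralSeq, h3, ← h1, ← h2]
    ring

theorem dihedralSeq_nonneg_of_two_le {c : ℝ} (hc : 2 ≤ c) (k : ℕ) :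
    0 ≤ dihedralSeq c k ∧ dihedralSeq c k < dihedralSeq c (k + 1) := by
  induction k with
  | zero => simp [dihedralSeq]
  | succ k ih =>
    refine ⟨by linarith, ?_⟩
    rw [dihedralSeq]
    nlinarith

/-- The Gram matrix entry attached to a Coxeter matrix entry `m`, where `0` stands for `∞`. -/
noncomputable def gramEntry (m : ℕ) : ℝ :=
  if m = 0 then -2 else -Real.cos (Real.pi / m)

theorem gramEntry_one : gramEntry 1 = 1 := by simp [gramEntry]

theorem gramEntry_zero : gramEntry 0 = -2 := by simp [gramEntry]

theorem sin_pi_div_pos {m : ℕ} (h0 : m ≠ 0) (h1 : m ≠ 1) : 0 < Real.sin (Real.pi / m) := by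
  have hm : (2 : ℝ) ≤ m := by exact_mod_cast (by omega : 2 ≤ m)
  apply Real.sin_pos_of_pos_of_lt_pi
  · have := Real.pi_pos
    positivity
  · apply div_lt_self Real.pi_pos
    linarith

/-- The form is non-degenerate on the plane of two simple roots. The usual entry `-1` for `∞` would
violate this; `-2` does not. -/
theorem gramEntry_sq_ne_one {m : ℕ} (h1 : m ≠ 1) : 1 - gramEntry m ^ 2 ≠ 0 := by
  rcases eq_or_ne m 0 with rfl | h0
  · norm_num [gramEntry]
  · have h := sin_pi_div_pos h0 h1
    have h2 := Real.sin_sq_add_cos_sq (Real.pi / m)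
    rw [gramEntry, if_neg h0]
    have : 0 < Real.sin (Real.pi / m) ^ 2 := by positivity
    nlinarith

theorem dihedralSeq_gramEntry_nonneg {m : ℕ} (h1 : m ≠ 1) {k : ℕ} (hk : m ≠ 0 → k ≤ m) :
    0 ≤ dihedralSeq (-(2 * gramEntry m)) k := by
  rcases eq_or_ne m 0 with rfl | h0
  · exact (dihedralSeq_nonneg_of_two_le (by norm_num [gramEntry]) k).1
  · have h := sin_pi_div_pos h0 h1
    have h2 := dihedralSeq_mul_sin (Real.pi / m) k
    rw [gramEntry, if_neg h0, mul_neg, neg_neg]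
    refine nonneg_of_mul_nonneg_left ?_ h
    rw [h2]
    have hm : (0 : ℝ) < m := by exact_mod_cast Nat.pos_of_ne_zero h0
    have hkm : (k : ℝ) ≤ m := by exact_mod_cast hk h0
    apply Real.sin_nonneg_of_nonneg_of_le_pi
    · have := Real.pi_pos
      positivity
    · rw [mul_div_assoc', div_le_iff₀ hm]
      nlinarith [Real.pi_pos]

/-- Each reflection changes only one of the two coordinates of the moving root, and does so by the
recursion of `dihedralSeq`. -/
theorem simpleReflection_mul_pow_apply {i j : ι} (hi : b i i = 1) (hj : b j j = 1)
    (hij : b i j = b j i) (k : ℕ) :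
    ((simpleReflection b i hi * simpleReflection b j hj) ^ k) (Pi.single i 1) =
      dihedralSeq (-(2 * b i j)) (2 * k + 1) • Pi.single i 1 +
        dihedralSeq (-(2 * b i j)) (2 * k) • Pi.single j 1 ∧
    (simpleReflection b j hj * (simpleReflection b i hi * simpleReflection b j hj) ^ k)
        (Pi.single i 1) =
      dihedralSeq (-(2 * b i j)) (2 * k + 1) • Pi.single i 1 +
        dihedralSeq (-(2 * b i j)) (2 * k + 2) • Pi.single j 1 := by
  have key : ∀ k, ((simpleReflection b i hi * simpleReflection b j hj) ^ k) (Pi.single i 1) =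
      dihedralSeq (-(2 * b i j)) (2 * k + 1) • Pi.single i 1 +
        dihedralSeq (-(2 * b i j)) (2 * k) • Pi.single j 1 →
    (simpleReflection b j hj * (simpleReflection b i hi * simpleReflection b j hj) ^ k)
        (Pi.single i 1) =
      dihedralSeq (-(2 * b i j)) (2 * k + 1) • Pi.single i 1 +
        dihedralSeq (-(2 * b i j)) (2 * k + 2) • Pi.single j 1 := by
    intro k h
    rw [LinearEquiv.mul_apply, h, map_add, map_smul, map_smul, simpleReflection_single,
      simpleReflection_single, hj, ← hij, dihedralSeq]
    module
  refine ⟨?_, key k ?_⟩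
  all_goals
    induction k with
    | zero => simp [dihedralSeq]
    | succ k ih =>
      rw [pow_succ', mul_assoc, LinearEquiv.mul_apply, key k ih, map_add, map_smul, map_smul,
        simpleReflection_single, simpleReflection_single, hi]
      have h := dihedralSeq_add_two (-(2 * b i j)) (2 * k + 1)
      rw [show 2 * (k + 1) + 1 = 2 * k + 1 + 2 by ring, h, show 2 * (k + 1) = 2 * k + 2 by ring]
      module

theorem linearEquiv_pow_apply_eq_self {R V : Type*} [Semiring R] [AddCommMonoid V] [Module R V]
    {T : V ≃ₗ[R] V} {v : V} (h : T v = v) (k : ℕ) : (T ^ k) v = v := by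
  induction k with
  | zero => rfl
  | succ k ih => rw [pow_succ, LinearEquiv.mul_apply, h, ih]

/-- The power fixes both roots, since the sines involved have period `2π`, and it fixes the
orthogonal complement of their plane; by non-degeneracy these span. -/
theorem simpleReflection_mul_pow_eq_one {i j : ι} (hi : b i i = 1) (hj : b j j = 1) {m : ℕ}
    (hb : b i j = gramEntry m) (hb' : b j i = gramEntry m) (hm : m ≠ 1) :
    (simpleReflection b i hi * simpleReflection b j hj) ^ m = 1 := by
  rcases eq_or_ne m 0 with rfl | h0
  · rw [pow_zero]
  have hs := sin_pi_div_pos h0 hm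
  have hm0 : (m : ℝ) ≠ 0 := by exact_mod_cast h0
  have hc : -(2 * gramEntry m) = 2 * Real.cos (Real.pi / m) := by
    rw [gramEntry, if_neg h0]; ring
  have h2 : dihedralSeq (-(2 * gramEntry m)) (2 * m) = 0 := by
    have h := dihedralSeq_mul_sin (Real.pi / m) (2 * m)
    rw [← hc] at h
    push_cast at h
    rw [show 2 * (m : ℝ) * (Real.pi / m) = 2 * Real.pi by field_simp, Real.sin_two_pi] at h
    exact (mul_eq_zero.1 h).resolve_right hs.ne'
  have h3 : dihedralSeq (-(2 * gramEntry m)) (2 * m + 1) = 1 := by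
    have h := dihedralSeq_mul_sin (Real.pi / m) (2 * m + 1)
    rw [← hc] at h
    push_cast at h
    rw [show (2 * (m : ℝ) + 1) * (Real.pi / m) = Real.pi / m + 2 * Real.pi by field_simp; ring,
      Real.sin_add_two_pi] at h
    exact mul_right_cancel₀ hs.ne' (by rw [h, one_mul])
  set T := simpleReflection b i hi * simpleReflection b j hj with hT
  have hTi : (T ^ m) (Pi.single i 1) = Pi.single i 1 := by
    rw [(simpleReflection_mul_pow_apply hi hj (hb.trans hb'.symm) m).1, hb, h2, h3]
    simp
  have hTj : (T ^ m) (Pi.single j 1) = Pi.single j 1 := by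
    have h4 := (simpleReflection_mul_pow_apply hj hi (hb'.trans hb.symm) m).1
    rw [hb', h2, h3, one_smul, zero_smul, add_zero] at h4
    have h5 : simpleReflection b j hj * simpleReflection b i hi = T⁻¹ := by
      rw [eq_inv_iff_mul_eq_one, hT, mul_assoc, ← mul_assoc (simpleReflection b i hi),
        simpleReflection_mul_self, one_mul, simpleReflection_mul_self]
    rw [h5] at h4
    conv_lhs => rw [← h4]
    rw [← LinearEquiv.mul_apply, inv_pow, mul_inv_cancel]
    rfl
  have hfix : ∀ v, simpleCoroot b i v = 0 → simpleCoroot b j v = 0 → (T ^ m) v = v := by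
    intro v h5 h6
    have h7 : T v = v := by
      rw [hT, LinearEquiv.mul_apply, simpleReflection_apply hj, h6, zero_smul, sub_zero,
        simpleReflection_apply hi, h5, zero_smul, sub_zero]
    exact linearEquiv_pow_apply_eq_self h7 m
  have hd : 1 - b i j ^ 2 ≠ 0 := by rw [hb]; exact gramEntry_sq_ne_one hm
  have hij : b j i = b i j := hb'.trans hb.symm
  ext1 v
  -- `x` and `y` solve the 2 × 2 Gram system for the orthogonal projection of `v` to the plane of
  -- the two roots.
  set x := (simpleCoroot b i v - b i j * simpleCoroot b j v) / (2 * (1 - b i j ^ 2)) with hx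
  set y := (simpleCoroot b j v - b i j * simpleCoroot b i v) / (2 * (1 - b i j ^ 2)) with hy
  have hv := hfix (v - x • Pi.single i 1 - y • Pi.single j 1)
    (by
      simp only [map_sub, map_smul, simpleCoroot_single, hi, smul_eq_mul, hx, hy]
      field_simp
      ring)
    (by
      simp only [map_sub, map_smul, simpleCoroot_single, hj, hij, smul_eq_mul, hx, hy]
      field_simp
      ring)
  rw [map_sub, map_sub, map_smul, map_smul, hTi, hTj] at hv
  simpa using hv

theorem simpleReflection_mul_ne_one {i j : ι} (hi : b i i = 1) (hj : b j j = 1) (hne : i ≠ j) :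
    simpleReflection b i hi * simpleReflection b j hj ≠ 1 := by
  intro h
  have h1 := congrFun (congrArg (fun T : (ι → ℝ) ≃ₗ[ℝ] (ι → ℝ) => T (Pi.single j 1)) h) j
  simp only [LinearEquiv.mul_apply, simpleReflection_single, hj, map_sub, map_smul] at h1
  norm_num [hne.symm, hne] at h1

/-- Splitting off the longest possible alternating suffix with additive lengths leaves `v` without
descents among the two letters. -/
theorem exists_eq_mul_alternatingWord {ι W : Type*} [Group W] {M : CoxeterMatrix ι}
    (cs : CoxeterSystem M W) (w : W) (i j : ι) (hj : cs.IsRightDescent w j) :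
    ∃ (v : W) (k : ℕ), 1 ≤ k ∧ w = v * cs.wordProd (alternatingWord i j k) ∧
      cs.length w = cs.length v + k ∧ ¬ cs.IsRightDescent v i ∧ ¬ cs.IsRightDescent v j := by
  classical
  set P : ℕ → Prop := fun k => ∃ v : W, w = v * cs.wordProd (alternatingWord i j k) ∧
    cs.length w = cs.length v + k with hP
  have hP1 : P 1 := by
    refine ⟨w * cs.simple j, ?_, ?_⟩
    · simp [alternatingWord]
    · have := (cs.isRightDescent_iff).1 hj
      omega
  have hbound : ∀ k, P k → k ≤ cs.length w := by
    rintro k ⟨v, -, h⟩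
    omega
  have h1w := hbound 1 hP1
  obtain ⟨v, hv, hl⟩ : P (Nat.findGreatest P (cs.length w)) :=
    Nat.findGreatest_spec h1w hP1
  have hk1 : 1 ≤ Nat.findGreatest P (cs.length w) := Nat.le_findGreatest h1w hP1
  have hmax : ¬ P (Nat.findGreatest P (cs.length w) + 1) := fun h =>
    Nat.findGreatest_is_greatest (Nat.lt_succ_self _) (hbound _ h) h
  generalize Nat.findGreatest P (cs.length w) = k at *
  obtain ⟨k, rfl⟩ : ∃ l, k = l + 1 := ⟨k - 1, by omega⟩
  -- The first letter of the suffix: as a descent of `v` it would cancel and make `w` too short.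
  have hA : ∀ x, (x = if Even k then j else i) → ¬ cs.IsRightDescent v x := by
    intro x hx hd
    have h2 := (cs.isRightDescent_iff).1 hd
    have h3 : w = v * cs.simple x * cs.wordProd (alternatingWord i j k) := by
      rw [hv, alternatingWord_succ', ← hx, cs.wordProd_cons, mul_assoc]
    have h4 := cs.length_mul_le (v * cs.simple x) (cs.wordProd (alternatingWord i j k))
    have h5 := cs.length_wordProd_le (alternatingWord i j k)
    rw [length_alternatingWord] at h5
    rw [← h3] at h4
    omega
  -- The other letter: as a descent of `v` it would prolong the suffix, against maximality.
  have hB : ∀ x, (x = if Even (k + 1) then j else i) → ¬ cs.IsRightDescent v x := by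
    intro x hx hd
    refine hmax ⟨v * cs.simple x, ?_, ?_⟩
    · rw [alternatingWord_succ', ← hx, cs.wordProd_cons, mul_assoc,
        cs.simple_mul_simple_cancel_left]
      exact hv
    · have h2 := (cs.isRightDescent_iff).1 hd
      omega
  refine ⟨v, k + 1, by omega, hv, hl, ?_⟩
  rcases Nat.even_or_odd k with h | h
  · exact ⟨hB i (by simp [Nat.even_add_one, h]), hA j (by simp [h])⟩
  · exact ⟨hA i (by simp [h]), hB j (by simp [h])⟩

/-- The Gram matrix of a Coxeter matrix, with `-2` in place of `-cos (π / ∞)`. -/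
noncomputable def coxeterGram {κ : Type*} (M : CoxeterMatrix κ) (i j : κ) : ℝ := gramEntry (M i j)

theorem coxeterGram_self {κ : Type*} (M : CoxeterMatrix κ) (i : κ) : coxeterGram M i i = 1 := by
  rw [coxeterGram, M.diagonal, gramEntry_one]

theorem coxeterGram_comm {κ : Type*} (M : CoxeterMatrix κ) (i j : κ) :
    coxeterGram M i j = coxeterGram M j i := by
  rw [coxeterGram, coxeterGram, M.symmetric]

variable {M : CoxeterMatrix ι} {W : Type*} [Group W] (cs : CoxeterSystem M W)

/-- The geometric representation of a Coxeter group. -/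
noncomputable def geometricRep : W →* ((ι → ℝ) ≃ₗ[ℝ] (ι → ℝ)) :=
  cs.lift ⟨fun i => simpleReflection (coxeterGram M) i (coxeterGram_self M i), by
    intro i j
    rcases eq_or_ne i j with rfl | hij
    · rw [M.diagonal, pow_one, simpleReflection_mul_self]
    · exact simpleReflection_mul_pow_eq_one _ _ rfl (coxeterGram_comm M j i)
        (M.off_diagonal i j hij)⟩

theorem geometricRep_simple (i : ι) :
    geometricRep cs (cs.simple i) =
      simpleReflection (coxeterGram M) i (coxeterGram_self M i) :=
  cs.lift_apply_simple _ i

/-- The coordinates are terms of `dihedralSeq` of index at most `k + 1`, and these are non-negative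
up to index `M i j`. -/
theorem geometricRep_alternatingWord_apply_nonneg {i j : ι} (hij : i ≠ j) {k : ℕ}
    (hk : M i j ≠ 0 → k + 1 ≤ M i j) :
    ∃ p q : ℝ, 0 ≤ p ∧ 0 ≤ q ∧
      geometricRep cs (cs.wordProd (alternatingWord i j k)) (Pi.single i 1) =
        p • Pi.single i 1 + q • Pi.single j 1 := by
  have hm := M.off_diagonal i j hij
  have key := simpleReflection_mul_pow_apply (coxeterGram_self M i) (coxeterGram_self M j)
    (coxeterGram_comm M i j) (k / 2)
  rw [cs.prod_alternatingWord_eq_mul_pow, map_mul, map_pow, map_mul, geometricRep_simple,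
    geometricRep_simple]
  have hnn : ∀ l ≤ k + 1, 0 ≤ dihedralSeq (-(2 * coxeterGram M i j)) l := fun l hl =>
    dihedralSeq_gramEntry_nonneg hm fun h0 => hl.trans (hk h0)
  rcases Nat.even_or_odd k with h | h
  · rw [if_pos h, map_one, one_mul, key.1]
    have := Nat.two_mul_div_two_of_even h
    exact ⟨_, _, hnn _ (by omega), hnn _ (by omega), rfl⟩
  · rw [if_neg (Nat.not_even_iff_odd.2 h), geometricRep_simple, key.2]
    have := Nat.two_mul_div_two_add_one_of_odd h
    exact ⟨_, _, hnn _ (by omega), hnn _ (by omega), rfl⟩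

/-- If `s_i` is not a right descent of `w`, then `w α_i` is a positive root. -/
theorem geometricRep_nonneg {w : W} {i : ι} (h : ¬ cs.IsRightDescent w i) :
    0 ≤ geometricRep cs w (Pi.single i 1) := by
  induction hn : cs.length w using Nat.strong_induction_on generalizing w i with
  | _ n ih =>
    rcases eq_or_ne w 1 with rfl | hw
    · simp
    obtain ⟨j, hj⟩ := cs.exists_rightDescent_of_ne_one hw
    have hij : i ≠ j := by rintro rfl; exact h hj
    -- The suffix is handled inside the dihedral group; since `k ≥ 1`, the shorter element `v` is
    -- handled by induction.
    obtain ⟨v, k, hk1, hv, hl, hvi, hvj⟩ := exists_eq_mul_alternatingWord cs w i j hj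
    -- As `s i` lengthens `w`, appending `i` to the suffix keeps it reduced, which bounds its length
    -- by `M i j`.
    have hk : M i j ≠ 0 → k + 1 ≤ M i j := by
      intro h0
      by_contra hlt
      have hred : ¬ cs.IsReduced (alternatingWord j i (k + 1)) :=
        cs.not_isReduced_alternatingWord j i (by rwa [M.symmetric])
          (by rw [M.symmetric]; omega)
      apply hred
      have h1 := (cs.not_isRightDescent_iff).1 h
      have h2 : w * cs.simple i = v * cs.wordProd (alternatingWord j i (k + 1)) := by
        rw [alternatingWord_succ, cs.wordProd_concat, ← mul_assoc, ← hv]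
      have h3 := cs.length_mul_le v (cs.wordProd (alternatingWord j i (k + 1)))
      have h4 := cs.length_wordProd_le (alternatingWord j i (k + 1))
      rw [← h2] at h3
      rw [CoxeterSystem.IsReduced]
      rw [length_alternatingWord] at h4 ⊢
      omega
    obtain ⟨p, q, hp, hq, hpq⟩ := geometricRep_alternatingWord_apply_nonneg cs hij hk
    rw [hv, map_mul, LinearEquiv.mul_apply, hpq, map_add, map_smul, map_smul]
    exact add_nonneg (smul_nonneg hp (ih _ (by omega) hvi rfl))
      (smul_nonneg hq (ih _ (by omega) hvj rfl))

theorem geometricRep_nonpos {w : W} {i : ι} (h : cs.IsRightDescent w i) :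
    geometricRep cs w (Pi.single i 1) ≤ 0 := by
  have h1 := geometricRep_nonneg cs ((cs.isRightDescent_iff_not_isRightDescent_mul).1 h)
  rw [map_mul, LinearEquiv.mul_apply, geometricRep_simple, simpleReflection_single,
    coxeterGram_self] at h1
  have h2 : (Pi.single i 1 - (2 * 1 : ℝ) • Pi.single i 1 : ι → ℝ) = -Pi.single i 1 := by module
  rw [h2, map_neg] at h1
  exact neg_nonneg.1 h1

theorem geometricRep_single_ne_zero (w : W) (i : ι) :
    geometricRep cs w (Pi.single i 1) ≠ 0 := by
  rw [Ne, LinearEquiv.map_eq_zero_iff]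
  simp

theorem isRightDescent_of_geometricRep_nonpos {w : W} {i : ι}
    (h : geometricRep cs w (Pi.single i 1) ≤ 0) : cs.IsRightDescent w i := by
  by_contra h1
  exact geometricRep_single_ne_zero cs w i (le_antisymm h (geometricRep_nonneg cs h1))

/-- This contains the faithfulness of the representation: a non-trivial element has a descent, and
so makes some simple root negative. -/
theorem eq_one_of_geometricRep_nonneg {w : W}
    (h : ∀ i, 0 ≤ geometricRep cs w (Pi.single i 1)) : w = 1 := by
  by_contra hw
  obtain ⟨i, hi⟩ := cs.exists_rightDescent_of_ne_one hw
  exact geometricRep_single_ne_zero cs w i (le_antisymm (geometricRep_nonpos cs hi) (h i))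

/-- No element of a Coxeter group makes two simple roots negative whose reflections generate an
infinite dihedral group. -/
theorem not_geometricRep_nonpos_of_eq_zero {w : W} {i j : ι} (hij : M i j = 0)
    (hi : geometricRep cs w (Pi.single i 1) ≤ 0)
    (hj : geometricRep cs w (Pi.single j 1) ≤ 0) : False := by
  have hne : i ≠ j := by
    rintro rfl
    simp at hij
  -- Non-negative combinations of the two roots stay negative under `w`, so multiplying `w`
  -- alternately by the two reflections would shorten it forever.
  have key : ∀ k, ∀ i j, M i j = 0 → i ≠ j →
      geometricRep cs w (Pi.single i 1) ≤ 0 →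
      geometricRep cs w (Pi.single j 1) ≤ 0 →
      cs.length (w * cs.wordProd (alternatingWord i j k)) + k ≤ cs.length w := by
    intro k
    induction k with
    | zero => simp [alternatingWord]
    | succ k ih =>
      intro i j hij hne hi hj
      obtain ⟨p, q, hp, hq, hpq⟩ := geometricRep_alternatingWord_apply_nonneg cs
        hne.symm (k := k) (by rw [M.symmetric, hij]; simp)
      have h1 := ih j i (by rwa [M.symmetric]) hne.symm hj hi
      have h2 : cs.IsRightDescent (w * cs.wordProd (alternatingWord j i k)) j := by
        apply isRightDescent_of_geometricRep_nonpos
        rw [map_mul, LinearEquiv.mul_apply, hpq, map_add, map_smul, map_smul]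
        exact add_nonpos (smul_nonpos_of_nonneg_of_nonpos hp hj)
          (smul_nonpos_of_nonneg_of_nonpos hq hi)
      have h3 := (cs.isRightDescent_iff).1 h2
      rw [alternatingWord_succ, cs.wordProd_concat, ← mul_assoc]
      omega
  have := key (cs.length w + 1) i j hij hne hi hj
  omega

end GeometricRepresentation

/-! ### Elements commuting with rotations; determinants and traces. -/

section Commutant

open Module CoxeterSystem

variable {ι : Type*} [Fintype ι] [DecidableEq ι] {M : CoxeterMatrix ι} {W : Type*} [Group W]
  (cs : CoxeterSystem M W)

theorem geometricRep_mul_apply_single (i j : ι) :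
    geometricRep cs (cs.simple i * cs.simple j) (Pi.single j 1) =
      (2 * coxeterGram M i j) • Pi.single i 1 - Pi.single j 1 := by
  rw [map_mul, LinearEquiv.mul_apply, geometricRep_simple, geometricRep_simple,
    simpleReflection_single, coxeterGram_self, map_sub, map_smul, simpleReflection_single]
  module

theorem geometricRep_mul_sub_apply_eq_zero (i j : ι) (v : ι → ℝ) {k : ι} (hki : k ≠ i)
    (hkj : k ≠ j) :
    (geometricRep cs (cs.simple i * cs.simple j) v - v) k = 0 := by
  rw [map_mul, LinearEquiv.mul_apply, geometricRep_simple, geometricRep_simple,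
    simpleReflection_apply, simpleReflection_apply]
  simp [hki, hkj]

/-- Together with the preceding lemma, used for both roots, this identifies the image of `s i * s j
- 1` with the plane of the two roots. The witness comes from inverting this operator on the plane.
-/
theorem exists_geometricRep_mul_sub_eq {i j : ι} (hij : i ≠ j) :
    ∃ v, geometricRep cs (cs.simple i * cs.simple j) v - v = Pi.single i 1 := by
  have hd : 1 - coxeterGram M i j ^ 2 ≠ 0 := gramEntry_sq_ne_one (M.off_diagonal i j hij)
  refine ⟨(-(2 * (1 - coxeterGram M i j ^ 2))⁻¹) •
    (Pi.single i 1 - coxeterGram M i j • Pi.single j 1), ?_⟩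
  rw [map_smul, map_sub, map_smul, geometricRep_mul_apply_single, map_mul, LinearEquiv.mul_apply,
    geometricRep_simple, geometricRep_simple, simpleReflection_single, map_sub, map_smul,
    simpleReflection_single, simpleReflection_single, coxeterGram_self, coxeterGram_comm M j i]
  match_scalars
  all_goals
    field_simp
    ring

/-- An element commuting with all products of two simple reflections acts diagonally. -/
theorem exists_geometricRep_single_eq_smul (h3 : ∀ i k : ι, ∃ j, i ≠ j ∧ k ≠ j) {w : W}
    (hw : ∀ i j, Commute w (cs.simple i * cs.simple j)) :
    ∃ c : ι → ℝ, (∀ i, geometricRep cs w (Pi.single i 1) = c i • Pi.single i 1) ∧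
      ∀ i j, coxeterGram M i j ≠ 0 → c i = c j := by
  have hcomm : ∀ i j v, geometricRep cs w (geometricRep cs (cs.simple i * cs.simple j) v) =
      geometricRep cs (cs.simple i * cs.simple j) (geometricRep cs w v) := by
    intro i j v
    rw [← LinearEquiv.mul_apply, ← LinearEquiv.mul_apply, ← map_mul, ← map_mul, (hw i j).eq]
  -- A commuting `w` preserves the image of each `s i * s j - 1`. Choosing `j` different from `i`
  -- and `k` shows that the image of the `i`-th root has no `k`-th coordinate.
  have hdiag : ∀ i, geometricRep cs w (Pi.single i 1) =
      geometricRep cs w (Pi.single i 1) i • Pi.single i 1 := by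
    intro i
    ext k
    rcases eq_or_ne k i with rfl | hki
    · simp
    · obtain ⟨j, hij, hkj⟩ := h3 i k
      obtain ⟨v, hv⟩ := exists_geometricRep_mul_sub_eq cs hij
      rw [← hv, map_sub, hcomm, geometricRep_mul_sub_apply_eq_zero cs i j _ hki hkj, hv]
      simp [hki]
  refine ⟨fun i => geometricRep cs w (Pi.single i 1) i, hdiag, fun i j hb => ?_⟩
  rcases eq_or_ne i j with rfl | hij
  · rfl
  -- The `i`-th coordinate of the commutation relation on the `j`-th root reads `2 b c i = 2 b c j`,
  -- with `b` the Gram entry.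
  have h := congrFun (hcomm i j (Pi.single j 1)) i
  rw [geometricRep_mul_apply_single, hdiag j, map_smul, geometricRep_mul_apply_single, map_sub,
    map_smul, hdiag i, hdiag j] at h
  simp only [Pi.sub_apply, Pi.smul_apply, Pi.single_eq_same, Pi.single_eq_of_ne hij, smul_eq_mul,
    mul_one, mul_zero, sub_zero] at h
  apply mul_left_cancel₀ (mul_ne_zero two_ne_zero hb)
  linarith

theorem det_simpleReflection {b : ι → ι → ℝ} {i : ι} (h : b i i = 1) :
    LinearEquiv.det (simpleReflection b i h) = -1 := by
  ext
  rw [LinearEquiv.coe_det]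
  have h1 : ((simpleReflection b i h : (ι → ℝ) ≃ₗ[ℝ] (ι → ℝ)) : (ι → ℝ) →ₗ[ℝ] (ι → ℝ)) =
      LinearMap.transvection (simpleCoroot b i) (-Pi.single i 1) := by
    refine LinearMap.ext fun v => ?_
    simp [LinearMap.transvection, simpleReflection_apply, sub_eq_add_neg]
  rw [h1, LinearMap.transvection.det, map_neg, simpleCoroot_single, h]
  norm_num

theorem det_eq_prod_of_single_eq_smul {T : (ι → ℝ) ≃ₗ[ℝ] (ι → ℝ)} {c : ι → ℝ}
    (h : ∀ i, T (Pi.single i 1) = c i • Pi.single i 1) :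
    (LinearEquiv.det T : ℝ) = ∏ i, c i := by
  have h1 : (T : (ι → ℝ) →ₗ[ℝ] (ι → ℝ)) = Matrix.toLin' (Matrix.diagonal c) := by
    apply LinearMap.pi_ext'
    intro i
    ext1
    simp [h, ← Pi.single_smul]
  rw [LinearEquiv.coe_det, h1, LinearMap.det_toLin', Matrix.det_diagonal]

/-- The trace is a conjugacy invariant from which the order of a peripheral generator will be read
off. -/
theorem trace_simpleReflection_mul {b : ι → ι → ℝ} {i j : ι} (hi : b i i = 1) (hj : b j j = 1)
    (hij : b i j = b j i) :
    LinearMap.trace ℝ (ι → ℝ)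
        (simpleReflection b i hi * simpleReflection b j hj : (ι → ℝ) ≃ₗ[ℝ] (ι → ℝ)) =
      Fintype.card ι - 4 + 4 * b i j ^ 2 := by
  have h1 : ((simpleReflection b i hi * simpleReflection b j hj : (ι → ℝ) ≃ₗ[ℝ] (ι → ℝ)) :
      (ι → ℝ) →ₗ[ℝ] (ι → ℝ)) = LinearMap.id - (simpleCoroot b i).smulRight (Pi.single i 1) -
        (simpleCoroot b j).smulRight (Pi.single j 1) +
        (2 * b i j) • (simpleCoroot b j).smulRight (Pi.single i 1) := by
    refine LinearMap.ext fun v => ?_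
    simp only [LinearEquiv.coe_coe, LinearEquiv.mul_apply, simpleReflection_apply, map_sub,
      map_smul, simpleCoroot_single, LinearMap.add_apply, LinearMap.sub_apply, LinearMap.id_apply,
      LinearMap.smulRight_apply, LinearMap.smul_apply]
    module
  rw [h1, map_add, map_sub, map_sub, map_smul, LinearMap.trace_smulRight,
    LinearMap.trace_smulRight, LinearMap.trace_smulRight, LinearMap.trace_id,
    simpleCoroot_single, simpleCoroot_single, simpleCoroot_single, hi, hj, hij, Module.finrank_pi]
  simp only [smul_eq_mul]
  ring

end Commutant

/-! ### Embedding of an orbisphere group in a polygon reflection group. -/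

section Polygon

open Module CoxeterSystem

variable {N : ℕ}

theorem prod_ofFn_mul_succ {W : Type*} [Group W] (a : ℕ → W) (ha : ∀ k, a k * a k = 1) (n : ℕ) :
    (List.ofFn fun i : Fin n => a i * a (i + 1)).prod = a 0 * a n := by
  induction n with
  | zero => simp [ha]
  | succ n ih =>
    rw [List.ofFn_succ', List.concat_eq_append, List.prod_append]
    simp only [Fin.val_castSucc, Fin.val_last, ih, List.prod_singleton]
    rw [mul_assoc, ← mul_assoc (a n), ha, one_mul]

theorem prod_ofFn_mul_cyclic_succ {W : Type*} [Group W] (r : Fin (N + 3) → W)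
    (hr : ∀ i, r i * r i = 1) : (List.ofFn fun i => r i * r (i + 1)).prod = 1 := by
  have h := prod_ofFn_mul_succ (fun k => r (Fin.ofNat (N + 3) k)) (fun k => hr _) (N + 3)
  have h1 : Fin.ofNat (N + 3) (N + 3) = Fin.ofNat (N + 3) 0 := by ext; simp
  rw [h1, hr] at h
  rw [← h]
  congr 2
  ext i
  have h2 : Fin.ofNat (N + 3) i = i := by ext; simp
  have h3 : Fin.ofNat (N + 3) (i + 1) = i + 1 := by ext; simp [Fin.val_add]
  rw [h2, h3]

/-- Involutions `r i` in cyclic order such that consecutive products have the right orders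
define a homomorphism from an orbisphere group. -/
def orbisphereLift {W : Type*} [Group W] {ord : Fin (N + 3) → ℕ∞} (r : Fin (N + 3) → W)
    (hr : ∀ i, r i * r i = 1) (hm : ∀ i, (r i * r (i + 1)) ^ (ord i).toNat = 1) :
    PresentedGroup (orbisphereRels ord) →* W :=
  PresentedGroup.toGroup (f := fun i => r i * r (i + 1)) (by
    rintro w (⟨i, k, hk, rfl⟩ | rfl)
    · have h := hm i
      rw [hk, ENat.toNat_natCast] at h
      rw [map_pow, FreeGroup.lift_apply_of, h]
    · rw [map_list_prod, List.map_ofFn]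
      simp only [Function.comp_def, FreeGroup.lift_apply_of]
      exact prod_ofFn_mul_cyclic_succ r hr)

theorem orbisphereLift_of {W : Type*} [Group W] {ord : Fin (N + 3) → ℕ∞} (r : Fin (N + 3) → W)
    (hr : ∀ i, r i * r i = 1) (hm : ∀ i, (r i * r (i + 1)) ^ (ord i).toNat = 1)
    (i : Fin (N + 3)) :
    orbisphereLift r hr hm (PresentedGroup.of i) = r i * r (i + 1) :=
  PresentedGroup.toGroup.of _

theorem add_one_ne_self (x : Fin (N + 3)) : x + 1 ≠ x := by
  rw [Ne, add_eq_left]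
  simp

theorem add_one_add_one_ne_self (x : Fin (N + 3)) : x + 1 + 1 ≠ x := by
  rw [Ne, add_assoc, add_eq_left]
  simp [Fin.ext_iff, Fin.val_add, Nat.mod_eq_of_lt]

theorem add_one_add_one_add_one_ne_self (hN : 1 ≤ N) (x : Fin (N + 3)) : x + 1 + 1 + 1 ≠ x := by
  rw [Ne, add_assoc, add_assoc, add_eq_left]
  intro h
  have h1 := congrArg Fin.val h
  simp only [Fin.val_add, Fin.val_one, Fin.val_zero] at h1
  rw [Nat.mod_eq_of_lt (a := 1 + 1) (by omega), Nat.mod_eq_of_lt (by omega)] at h1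
  omega

/-- The Coxeter matrix of the reflection group of a polygon with angles `π / m x`, the vertex with
angle `π / m x` lying between the sides `x` and `x + 1`. -/
def polygonMatrix (m : Fin (N + 3) → ℕ) (hm : ∀ x, m x ≠ 1) : CoxeterMatrix (Fin (N + 3)) where
  -- Sides without a common vertex get `0`, that is `∞`: no relation.
  M x y := if x = y then 1 else if y = x + 1 then m x else if x = y + 1 then m y else 0
  isSymm := by
    apply Matrix.IsSymm.ext
    intro x y
    have h := add_one_add_one_ne_self x
    have h' := add_one_add_one_ne_self y
    grind
  diagonal x := if_pos rfl
  off_diagonal x y hxy := by grind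

theorem polygonMatrix_apply (m : Fin (N + 3) → ℕ) (hm : ∀ x, m x ≠ 1) (x y : Fin (N + 3)) :
    polygonMatrix m hm x y =
      if x = y then 1 else if y = x + 1 then m x else if x = y + 1 then m y else 0 := rfl

theorem polygonMatrix_succ (m : Fin (N + 3) → ℕ) (hm : ∀ x, m x ≠ 1) (x : Fin (N + 3)) :
    polygonMatrix m hm x (x + 1) = m x := by
  rw [polygonMatrix_apply, if_neg (add_one_ne_self x).symm, if_pos rfl]

theorem polygonMatrix_add_two (hN : 1 ≤ N) (m : Fin (N + 3) → ℕ) (hm : ∀ x, m x ≠ 1)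
    (x : Fin (N + 3)) : polygonMatrix m hm x (x + 1 + 1) = 0 := by
  have h1 := add_one_ne_self (x + 1)
  have h2 := add_one_add_one_ne_self x
  have h3 := add_one_add_one_add_one_ne_self hN x
  rw [polygonMatrix_apply, if_neg h2.symm, if_neg h1, if_neg h3.symm]

/-- The action by left multiplication on `G ⊔ s₀ G` of an involution `s` with `s₀ s = a`, where
`s₀` is an involution. -/
def halfTurn {G : Type*} [Group G] (a : G) : Equiv.Perm (G × Bool) where
  toFun p := if p.2 then (a⁻¹ * p.1, false) else (a * p.1, true)
  invFun p := if p.2 then (a⁻¹ * p.1, false) else (a * p.1, true)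
  left_inv := by rintro ⟨g, _ | _⟩ <;> simp
  right_inv := by rintro ⟨g, _ | _⟩ <;> simp

theorem halfTurn_mul_self {G : Type*} [Group G] (a : G) : halfTurn a * halfTurn a = 1 := by
  ext1 p
  exact (halfTurn a).left_inv p

theorem halfTurn_mul_pow_apply {G : Type*} [Group G] (a a' : G) (k : ℕ) (g : G) :
    ((halfTurn a * halfTurn a') ^ k) (g, false) = ((a⁻¹ * a') ^ k * g, false) ∧
      ((halfTurn a * halfTurn a') ^ k) (g, true) = ((a * a'⁻¹) ^ k * g, true) := by
  induction k generalizing g with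
  | zero => simp
  | succ k ih =>
    constructor
    · have h : (halfTurn a * halfTurn a') (g, false) = (a⁻¹ * a' * g, false) := by
        simp [halfTurn, mul_assoc]
      rw [pow_succ, Equiv.Perm.mul_apply, h, (ih _).1, pow_succ, ← mul_assoc]
    · have h : (halfTurn a * halfTurn a') (g, true) = (a * a'⁻¹ * g, true) := by
        simp [halfTurn, mul_assoc]
      rw [pow_succ, Equiv.Perm.mul_apply, h, (ih _).2, pow_succ, ← mul_assoc]

theorem halfTurn_mul_pow_eq_one {G : Type*} [Group G] {a a' : G} {k : ℕ}
    (h : (a⁻¹ * a') ^ k = 1) : (halfTurn a * halfTurn a') ^ k = 1 := by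
  have h' : (a * a'⁻¹) ^ k = 1 := by
    have h1 : a * a'⁻¹ = a * (a⁻¹ * a')⁻¹ * a⁻¹ := by group
    rw [h1, conj_pow, inv_pow, h]
    simp
  ext1 ⟨g, _ | _⟩
  · rw [(halfTurn_mul_pow_apply a a' k g).1, h, one_mul]; rfl
  · rw [(halfTurn_mul_pow_apply a a' k g).2, h', one_mul]; rfl

theorem orbisphereRels_pow {n : ℕ} (ord : Fin n → ℕ∞) (i : Fin n) :
    (PresentedGroup.of i : PresentedGroup (orbisphereRels ord)) ^ (ord i).toNat = 1 := by
  rcases eq_or_ne (ord i) ⊤ with h | h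
  · rw [h, ENat.toNat_top, pow_zero]
  · rw [PresentedGroup.of, ← map_pow]
    exact PresentedGroup.one_of_mem (Or.inl ⟨i, _, (ENat.natCast_toNat h).symm, rfl⟩)

theorem orbisphereRels_prod {n : ℕ} (ord : Fin n → ℕ∞) :
    (List.ofFn fun i => (PresentedGroup.of i : PresentedGroup (orbisphereRels ord))).prod = 1 := by
  have h := PresentedGroup.one_of_mem (rels := orbisphereRels ord) (Or.inr rfl)
  rw [map_list_prod, List.map_ofFn] at h
  exact h

/-- An infinite order has `toNat` equal to `0`, which is also the Coxeter code for `∞`, so `toNat`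
translates orders into Coxeter entries. -/
theorem toNat_ne_one_of_two_le {m : ℕ∞} (h : 2 ≤ m) : m.toNat ≠ 1 := by
  intro h1
  rcases eq_or_ne m ⊤ with ht | ht
  · rw [ht] at h1
    simp at h1
  · rw [← ENat.natCast_toNat ht, h1] at h
    exact absurd h (by decide)

/-- The polygon group into which an orbisphere group embeds with index two. -/
def orbisphereMatrix (ord : Fin (N + 3) → ℕ∞) (hord : ∀ i, 2 ≤ ord i) :
    CoxeterMatrix (Fin (N + 3)) :=
  polygonMatrix (fun i => (ord i).toNat) fun i => toNat_ne_one_of_two_le (hord i)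

theorem prod_take_succ_ofFn {G : Type*} [Group G] {n : ℕ} (γ : Fin n → G) (i : Fin n) :
    ((List.ofFn γ).take (i + 1)).prod = ((List.ofFn γ).take i).prod * γ i := by
  rw [List.prod_take_succ _ _ (by rw [List.length_ofFn]; exact i.2)]
  congr 1
  simp

/-- Take the partial products of the generators; they close up cyclically because the full product
is `1`. -/
theorem exists_orbispherePrefix (ord : Fin (N + 3) → ℕ∞) :
    ∃ a : Fin (N + 3) → PresentedGroup (orbisphereRels ord),
      ∀ i, (a i)⁻¹ * a (i + 1) = PresentedGroup.of i := by
  set γ : Fin (N + 3) → PresentedGroup (orbisphereRels ord) := fun i => PresentedGroup.of i with hγ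
  refine ⟨fun i => ((List.ofFn γ).take i).prod, fun i => ?_⟩
  have h1 : ((List.ofFn γ).take (i + 1 : ℕ)).prod = ((List.ofFn γ).take i).prod * γ i :=
    prod_take_succ_ofFn γ i
  have h2 : ((List.ofFn γ).take ((i + 1 : Fin (N + 3)) : ℕ)).prod =
      ((List.ofFn γ).take (i + 1 : ℕ)).prod := by
    rcases eq_or_ne i (Fin.last _) with rfl | hi
    · have h3 := orbisphereRels_prod ord
      rw [Fin.last_add_one, Fin.val_zero, Fin.val_last, List.take_zero,
        List.prod_nil, List.take_of_length_le (by rw [List.length_ofFn]), h3]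
    · rw [Fin.val_add_one_of_lt (lt_of_le_of_ne (Fin.le_last i) hi)]
  change (_)⁻¹ * ((List.ofFn γ).take ((i + 1 : Fin (N + 3)) : ℕ)).prod = γ i
  rw [h2, h1, inv_mul_cancel_left]

section

variable (ord : Fin (N + 3) → ℕ∞) (hord : ∀ i, 2 ≤ ord i)

/-- The embedding of an orbisphere group in a polygon group. -/
def orbisphereToCoxeter :
    PresentedGroup (orbisphereRels ord) →* (orbisphereMatrix ord hord).Group :=
  orbisphereLift (orbisphereMatrix ord hord).toCoxeterSystem.simple
    (fun i => simple_mul_simple_self _ i) fun i => by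
      have h := (orbisphereMatrix ord hord).toCoxeterSystem.simple_mul_simple_pow i (i + 1)
      rwa [orbisphereMatrix, polygonMatrix_succ] at h

theorem orbisphereToCoxeter_of (i : Fin (N + 3)) :
    orbisphereToCoxeter ord hord (PresentedGroup.of i) =
      (orbisphereMatrix ord hord).toCoxeterSystem.simple i *
        (orbisphereMatrix ord hord).toCoxeterSystem.simple (i + 1) :=
  orbisphereLift_of _ _ _ i

theorem orbisphereToCoxeter_injective : Function.Injective (orbisphereToCoxeter ord hord) := by
  obtain ⟨a, ha⟩ := exists_orbispherePrefix ord
  -- The reflections act on two copies of the orbisphere group by half turns. The image of `z` then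
  -- acts on one copy as left multiplication by `z`, so `z` can be recovered.
  have hlift : (orbisphereMatrix ord hord).IsLiftable fun i => halfTurn (a i) := by
    have hs : ∀ i, (halfTurn (a i) * halfTurn (a (i + 1))) ^ (ord i).toNat = 1 := fun i =>
      halfTurn_mul_pow_eq_one (by rw [ha, orbisphereRels_pow])
    intro x y
    rw [orbisphereMatrix, polygonMatrix_apply]
    split_ifs with h1 h2 h3
    · rw [h1, pow_one, halfTurn_mul_self]
    · rw [h2]
      exact hs x
    · rw [h3, ← inv_inj, inv_one, ← inv_pow, mul_inv_rev, ← hs y]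
      congr 1
    · rw [pow_zero]
  set Φ := (orbisphereMatrix ord hord).toCoxeterSystem.lift ⟨_, hlift⟩ with hΦ
  have key : ∀ z g, Φ (orbisphereToCoxeter ord hord z) (g, false) = (z * g, false) := by
    intro z
    induction z using PresentedGroup.induction_on with
    | _ z =>
    induction z using FreeGroup.induction_on with
    | C1 => intro g; simp
    | of i =>
      intro g
      have h := (halfTurn_mul_pow_apply (a i) (a (i + 1)) 1 g).1
      rw [ha, pow_one, pow_one] at h
      change Φ (orbisphereToCoxeter ord hord (PresentedGroup.of i)) _ = (PresentedGroup.of i * g, _)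
      rw [orbisphereToCoxeter_of, map_mul, hΦ, lift_apply_simple, lift_apply_simple]
      exact h
    | inv_of i h =>
      intro g
      rw [map_inv, map_inv, map_inv, Equiv.Perm.inv_eq_iff_eq, h]
      simp
    | mul x y hx hy =>
      intro g
      rw [map_mul, map_mul, map_mul, Equiv.Perm.mul_apply, hy, hx, mul_assoc]
  rw [injective_iff_map_eq_one]
  intro z hz
  have h := key z 1
  rw [hz, map_one, mul_one] at h
  exact (congrArg Prod.fst h).symm

end

end Polygon

/-! ### Peripheral classes are non-trivial and distinct. -/

section PeripheralClasses

open Module CoxeterSystem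

/-- For finite entries the cosine is non-negative and injective on the angles `π / m ≤ π / 2`; the
entry for `∞` has square `4 > 1`. -/
theorem eq_of_gramEntry_sq_eq {m k : ℕ} (hm : m ≠ 1) (hk : k ≠ 1)
    (h : gramEntry m ^ 2 = gramEntry k ^ 2) : m = k := by
  have hrange : ∀ l : ℕ, l ≠ 0 → l ≠ 1 → Real.pi / l ∈ Set.Icc 0 Real.pi ∧
      0 ≤ Real.cos (Real.pi / l) := by
    intro l h0 h1
    have hl : (2 : ℝ) ≤ l := by exact_mod_cast (by omega : 2 ≤ l)
    have hpi := Real.pi_pos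
    have h2 : Real.pi / l ≤ Real.pi / 2 := by gcongr
    have h3 : 0 ≤ Real.pi / l := by positivity
    exact ⟨⟨h3, by linarith⟩, Real.cos_nonneg_of_mem_Icc ⟨by linarith, h2⟩⟩
  rcases eq_or_ne m 0 with rfl | hm0 <;> rcases eq_or_ne k 0 with rfl | hk0
  · rfl
  · rw [gramEntry_zero, gramEntry, if_neg hk0] at h
    nlinarith [Real.cos_sq_le_one (Real.pi / k)]
  · rw [gramEntry_zero, gramEntry, if_neg hm0] at h
    nlinarith [Real.cos_sq_le_one (Real.pi / m)]
  · rw [gramEntry, gramEntry, if_neg hm0, if_neg hk0, neg_sq, neg_sq] at h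
    have h1 := (sq_eq_sq₀ (hrange m hm0 hm).2 (hrange k hk0 hk).2).1 h
    have h2 := Real.injOn_cos (hrange m hm0 hm).1 (hrange k hk0 hk).1 h1
    have hpi := Real.pi_ne_zero
    have : (m : ℝ) ≠ 0 := by exact_mod_cast hm0
    have : (k : ℝ) ≠ 0 := by exact_mod_cast hk0
    field_simp at h2
    exact_mod_cast h2.symm

theorem gramEntry_two : gramEntry 2 = 0 := by simp [gramEntry]

/-- The `v i` define a homomorphism to an abelian group, where conjugate elements have equal images.
-/
theorem eq_of_isConj_of {n : ℕ} {ord : Fin n → ℕ∞} {A : Type*} [AddCommGroup A] (v : Fin n → A)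
    (hsum : ∑ i, v i = 0) (hv : ∀ i, (ord i).toNat • v i = 0) {i j : Fin n}
    (h : IsConj (PresentedGroup.of i : PresentedGroup (orbisphereRels ord))
      (PresentedGroup.of j)) : v i = v j := by
  have hf : ∀ w ∈ orbisphereRels ord,
      FreeGroup.lift (fun i => Multiplicative.ofAdd (v i)) w = 1 := by
    rintro w (⟨i, k, hk, rfl⟩ | rfl)
    · have h := hv i
      rw [hk, ENat.toNat_natCast] at h
      rw [map_pow, FreeGroup.lift_apply_of, ← ofAdd_nsmul, h, ofAdd_zero]
    · rw [map_list_prod, List.map_ofFn]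
      simp only [Function.comp_def, FreeGroup.lift_apply_of]
      rw [List.prod_ofFn, ← ofAdd_sum, hsum, ofAdd_zero]
  have h1 := isConj_iff_eq.1 (MonoidHom.map_isConj (PresentedGroup.toGroup hf) h)
  rw [PresentedGroup.toGroup.of, PresentedGroup.toGroup.of] at h1
  exact Multiplicative.ofAdd.injective h1

variable {N : ℕ}

theorem orbisphere_of_ne_one {ord : Fin (N + 3) → ℕ∞} (hord : ∀ i, 2 ≤ ord i) (i : Fin (N + 3)) :
    (PresentedGroup.of i : PresentedGroup (orbisphereRels ord)) ≠ 1 := by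
  intro h
  have h1 := orbisphereToCoxeter_of ord hord i
  rw [h, map_one] at h1
  have h2 := congrArg (geometricRep (orbisphereMatrix ord hord).toCoxeterSystem) h1
  rw [map_one, map_mul, geometricRep_simple, geometricRep_simple] at h2
  exact simpleReflection_mul_ne_one _ _ (add_one_ne_self i).symm h2.symm

/-- The Coxeter matrix of the polygon obtained by contracting the side `i + 1`, the vertex `i`
being deleted. -/
def contractedMatrix (i : Fin (N + 3)) (m : Fin (N + 3) → ℕ) (hm : ∀ x, m x ≠ 1) :
    CoxeterMatrix (Fin (N + 3)) where
  M x y := if x = y then 1 else if y = x + 1 then m x else if x = y + 1 then m y else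
    if (x = i ∧ y = i + 1 + 1) ∨ (y = i ∧ x = i + 1 + 1) then m (i + 1) else 0
  isSymm := by
    apply Matrix.IsSymm.ext
    intro x y
    have h := add_one_add_one_ne_self x
    have h' := add_one_add_one_ne_self y
    grind
  diagonal x := if_pos rfl
  off_diagonal x y hxy := by grind

/-- Killing the generator `i` leaves a polygon with at least three sides, in which every other
generator survives; so none of them is conjugate to it. -/
theorem orbisphere_isConj_of_one_le (hN : 1 ≤ N) {ord : Fin (N + 3) → ℕ∞}
    (hord : ∀ i, 2 ≤ ord i) {i j : Fin (N + 3)}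
    (h : IsConj (PresentedGroup.of i : PresentedGroup (orbisphereRels ord))
      (PresentedGroup.of j)) : i = j := by
  by_contra hij
  set M := contractedMatrix i (fun i => (ord i).toNat) fun i => toNat_ne_one_of_two_le (hord i)
    with hM
  have hMa : ∀ x y, M x y = if x = y then 1 else if y = x + 1 then (ord x).toNat else
    if x = y + 1 then (ord y).toNat else
    if (x = i ∧ y = i + 1 + 1) ∨ (y = i ∧ x = i + 1 + 1) then (ord (i + 1)).toNat else 0 :=
    fun x y => rfl
  -- Side `i + 1` is replaced by side `i`, so that generator `i` maps to `1`; the simple reflection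
  -- `i + 1` of `M` is not hit.
  set c : Fin (N + 3) → Fin (N + 3) := fun x => if x = i + 1 then i else x with hc
  set r : Fin (N + 3) → M.Group := fun x => M.toCoxeterSystem.simple (c x) with hr
  have hr2 : ∀ x, r x * r x = 1 := fun x => simple_mul_simple_self _ _
  have h1 := add_one_ne_self (N := N)
  have h2 := add_one_add_one_ne_self (N := N)
  have h3 := add_one_add_one_add_one_ne_self hN
  have hinj : ∀ x, c x = c (x + 1) → x = i := by
    intro x hx
    have e1 := h1 x
    have e2 := h1 i
    have e3 := h1 (i + 1)
    have e4 := h2 i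
    by_contra hxi
    have e5 : x + 1 ≠ i + 1 := fun h => hxi (add_right_cancel h)
    grind
  have hrm : ∀ x, (r x * r (x + 1)) ^ (ord x).toNat = 1 := by
    intro x
    rcases eq_or_ne x i with rfl | hxi
    · have : c x = c (x + 1) := by
        have := h1 x
        grind
      simp only [hr]
      rw [← this, simple_mul_simple_self, one_pow]
    · have : M (c x) (c (x + 1)) = (ord x).toNat := by
        rw [hMa, if_neg fun h => hxi (hinj x h)]
        have e1 := h1 x
        have e2 := h1 i
        have e3 := h1 (i + 1)
        have e4 := h2 i
        have e6 := h3 i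
        have e5 : x + 1 ≠ i + 1 := fun h => hxi (add_right_cancel h)
        grind
      rw [← this]
      exact simple_mul_simple_pow _ _ _
  have h4 := MonoidHom.map_isConj (orbisphereLift r hr2 hrm) h
  rw [orbisphereLift_of, orbisphereLift_of] at h4
  have h5 : r i * r (i + 1) = 1 := by
    have : c i = c (i + 1) := by
      have := h1 i
      grind
    simp only [hr]
    rw [← this, simple_mul_simple_self]
  rw [h5, isConj_one_right] at h4
  have h6 := congrArg (geometricRep M.toCoxeterSystem) h4
  rw [map_one, map_mul, geometricRep_simple, geometricRep_simple] at h6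
  exact simpleReflection_mul_ne_one _ _ (fun h => hij (hinj j h).symm) h6

theorem sum_fin_zero_add_three {A : Type*} [AddCommMonoid A] (f : Fin (0 + 3) → A)
    (x : Fin (0 + 3)) : ∑ i, f i = f x + f (x + 1) + f (x + 1 + 1) := by
  rw [← Equiv.sum_comp (Equiv.addLeft x) f]
  change ∑ i : Fin 3, _ = _
  rw [Fin.sum_univ_three]
  simp only [Equiv.coe_addLeft, add_assoc]
  congr 2
  · exact add_zero x

theorem prod_fin_zero_add_three {A : Type*} [CommMonoid A] (f : Fin (0 + 3) → A)
    (x : Fin (0 + 3)) : ∏ i, f i = f x * f (x + 1) * f (x + 1 + 1) :=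
  sum_fin_zero_add_three (A := Additive A) f x

/-- Orders `(2, 2, k)` with `k` finite have Euler characteristic `1 / k > 0`. -/
theorem toNat_eq_zero_of_eq_two {ord : Fin (0 + 3) → ℕ∞} (hχ : orbisphereEulerChar ord ≤ 0)
    {x : Fin (0 + 3)} (h1 : (ord x).toNat = 2) (h2 : (ord (x + 1)).toNat = 2) :
    (ord (x + 1 + 1)).toNat = 0 := by
  rw [orbisphereEulerChar, sum_fin_zero_add_three _ x, h1, h2] at hχ
  by_contra h
  have : (0 : ℚ) < ((ord (x + 1 + 1)).toNat : ℚ)⁻¹ :=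
    inv_pos.2 (by exact_mod_cast Nat.pos_of_ne_zero h)
  push_cast at hχ
  linarith

theorem eq_or_eq_of_ne {i j : Fin (0 + 3)} (h : i ≠ j) : j = i + 1 ∨ i = j + 1 := by
  revert i j
  decide

theorem eq_or_eq_or_eq (i k : Fin (0 + 3)) : k = i ∨ k = i + 1 ∨ k = i + 1 + 1 := by
  revert i k
  decide

theorem orbisphere_toNat_eq_of_isConj {ord : Fin (N + 3) → ℕ∞} (hord : ∀ i, 2 ≤ ord i)
    {i j : Fin (N + 3)}
    (h : IsConj (PresentedGroup.of i : PresentedGroup (orbisphereRels ord))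
      (PresentedGroup.of j)) : (ord i).toNat = (ord j).toNat := by
  have htr : ∀ i, LinearMap.trace ℝ (Fin (N + 3) → ℝ)
      (geometricRep (orbisphereMatrix ord hord).toCoxeterSystem
        (orbisphereToCoxeter ord hord (PresentedGroup.of i)) :
          (Fin (N + 3) → ℝ) ≃ₗ[ℝ] (Fin (N + 3) → ℝ)) =
      Fintype.card (Fin (N + 3)) - 4 + 4 * gramEntry (ord i).toNat ^ 2 := by
    intro i
    rw [orbisphereToCoxeter_of, map_mul, geometricRep_simple, geometricRep_simple,
      trace_simpleReflection_mul _ _ (coxeterGram_comm _ _ _), coxeterGram, orbisphereMatrix,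
      polygonMatrix_succ]
  obtain ⟨g, hg⟩ := isConj_iff.1 h
  have h1 := htr j
  set T := geometricRep (orbisphereMatrix ord hord).toCoxeterSystem
    (orbisphereToCoxeter ord hord g) with hT
  rw [← hg, map_mul, map_mul, map_mul, map_mul, map_inv, map_inv, ← hT] at h1
  have h2 := LinearMap.trace_conj' (R := ℝ)
    ((geometricRep (orbisphereMatrix ord hord).toCoxeterSystem
        (orbisphereToCoxeter ord hord (PresentedGroup.of i)) :
          (Fin (N + 3) → ℝ) ≃ₗ[ℝ] (Fin (N + 3) → ℝ)) :
          (Fin (N + 3) → ℝ) →ₗ[ℝ] (Fin (N + 3) → ℝ)) T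
  have h3 := (h2.symm.trans h1).symm.trans (htr i)
  apply eq_of_gramEntry_sq_eq (toNat_ne_one_of_two_le (hord i)) (toNat_ne_one_of_two_le (hord j))
  linarith

theorem orbisphere_not_isConj_succ {ord : Fin (0 + 3) → ℕ∞} (hord : ∀ i, 2 ≤ ord i)
    (hχ : orbisphereEulerChar ord ≤ 0) (i : Fin (0 + 3)) :
    ¬ IsConj (PresentedGroup.of i : PresentedGroup (orbisphereRels ord))
      (PresentedGroup.of (i + 1)) := by
  intro h
  have hm := orbisphere_toNat_eq_of_isConj hord h
  have e1 : i + 1 ≠ i := add_one_ne_self i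
  have e2 : i + 1 + 1 ≠ i := add_one_add_one_ne_self i
  have e3 : i + 1 + 1 ≠ i + 1 := add_one_ne_self (i + 1)
  have hcases : ∀ k, k = i ∨ k = i + 1 ∨ k = i + 1 + 1 := eq_or_eq_or_eq i
  by_cases h2 : (ord i).toNat = 2
  · have h0 := toNat_eq_zero_of_eq_two hχ h2 (hm.symm.trans h2)
    -- With orders `(2, 2, ∞)`, generator `i` and the one of infinite order go to `1`, the remaining
    -- one to `0`.
    have := eq_of_isConj_of (A := ZMod 2) (fun k => if k = i + 1 then 0 else 1)
      (by
        rw [sum_fin_zero_add_three _ i]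
        simp only [e1.symm, e3, if_true, if_false]
        decide)
      (by
        intro k
        rcases hcases k with rfl | rfl | rfl
        · rw [h2]
          simp only [e1.symm, if_false]
          decide
        · simp
        · rw [h0, zero_smul]) h
    simp [e1.symm] at this
  -- For common order `m ≠ 2` the two generators go to `1` and `-1`, which differ modulo `m`; for `m
  -- = ∞` the target is `ZMod 0 = ℤ`.
  · have := eq_of_isConj_of (A := ZMod (ord i).toNat)
      (fun k => if k = i then 1 else if k = i + 1 then -1 else 0)
      (by
        rw [sum_fin_zero_add_three _ i]
        simp [e1, e2, e3])
      (by
        intro k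
        rcases hcases k with rfl | rfl | rfl
        · simp
        · simp [e1, ← hm]
        · simp [e2, e3]) h
    simp only [if_true, e1, if_false] at this
    have h3 : ((2 : ℕ) : ZMod (ord i).toNat) = 0 := by
      push_cast
      linear_combination this
    rw [ZMod.natCast_eq_zero_iff] at h3
    have h4 := toNat_ne_one_of_two_le (hord i)
    rcases (Nat.dvd_prime Nat.prime_two).1 h3 with h5 | h5
    · exact h4 h5
    · exact h2 h5

/-- The peripheral classes of an orbisphere group of non-positive Euler characteristic are
distinct. -/
theorem orbisphere_eq_of_isConj {ord : Fin (N + 3) → ℕ∞} (hord : ∀ i, 2 ≤ ord i)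
    (hχ : orbisphereEulerChar ord ≤ 0) {i j : Fin (N + 3)}
    (h : IsConj (PresentedGroup.of i : PresentedGroup (orbisphereRels ord))
      (PresentedGroup.of j)) : i = j := by
  rcases Nat.eq_zero_or_pos N with rfl | hN
  · by_contra hij
    rcases eq_or_eq_of_ne hij with rfl | rfl
    · exact orbisphere_not_isConj_succ hord hχ _ h
    · exact orbisphere_not_isConj_succ hord hχ _ h.symm
  · exact orbisphere_isConj_of_one_le hN hord h

end PeripheralClasses

/-! ### Triviality of the center. -/

section Center

open Module CoxeterSystem

variable {N : ℕ} {ord : Fin (N + 3) → ℕ∞} (hord : ∀ i, 2 ≤ ord i)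

theorem orbisphere_det_eq_one (z : PresentedGroup (orbisphereRels ord)) :
    LinearEquiv.det (geometricRep (orbisphereMatrix ord hord).toCoxeterSystem
      (orbisphereToCoxeter ord hord z)) = 1 := by
  have h : (LinearEquiv.det.comp ((geometricRep (orbisphereMatrix ord hord).toCoxeterSystem).comp
      (orbisphereToCoxeter ord hord))) = 1 := by
    apply PresentedGroup.ext
    intro i
    simp only [MonoidHom.comp_apply, orbisphereToCoxeter_of, map_mul, geometricRep_simple,
      det_simpleReflection, MonoidHom.one_apply]
    norm_num
  exact DFunLike.congr_fun h z

/-- Products of neighbouring reflections generate all products of two reflections. -/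
theorem commute_simple_mul_simple {W : Type*} [Group W] {M : CoxeterMatrix (Fin (N + 3))}
    (cs : CoxeterSystem M W) {w : W} (h : ∀ i, Commute w (cs.simple i * cs.simple (i + 1)))
    (i j : Fin (N + 3)) : Commute w (cs.simple i * cs.simple j) := by
  have h0 : ∀ i, Commute w (cs.simple 0 * cs.simple i) := by
    intro i
    induction i using Fin.induction with
    | zero => rw [simple_mul_simple_self]; exact Commute.one_right _
    | succ k ih =>
      have := ih.mul_right (h k.castSucc)
      rwa [mul_assoc, simple_mul_simple_cancel_left, Fin.coeSucc_eq_succ] at this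
  have := (h0 i).inv_right.mul_right (h0 j)
  rwa [mul_inv_rev, inv_simple, inv_simple, mul_assoc, simple_mul_simple_cancel_left] at this

theorem exists_third (i k : Fin (N + 3)) : ∃ j, i ≠ j ∧ k ≠ j := by
  obtain ⟨j, hj⟩ := Finset.exists_mem_notMem_of_card_lt_card
    (s := {i, k}) (t := (Finset.univ : Finset (Fin (N + 3))))
    (Finset.card_le_two.trans_lt (by simp))
  simp only [Finset.mem_univ, true_and, Finset.mem_insert, Finset.mem_singleton, not_or] at hj
  exact ⟨j, Ne.symm hj.1, Ne.symm hj.2⟩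

/-- An orbisphere group of non-positive Euler characteristic has trivial center. -/
theorem orbisphere_eq_one_of_commute (hord : ∀ i, 2 ≤ ord i) (hχ : orbisphereEulerChar ord ≤ 0)
    {z : PresentedGroup (orbisphereRels ord)} (hz : ∀ g, Commute z g) : z = 1 := by
  set M := orbisphereMatrix ord hord with hM
  set cs := M.toCoxeterSystem with hcs
  set w := orbisphereToCoxeter ord hord z with hw
  have hcomm : ∀ i, Commute w (cs.simple i * cs.simple (i + 1)) := by
    intro i
    rw [← orbisphereToCoxeter_of]
    exact (hz _).map _
  obtain ⟨c, hc, hcc⟩ := exists_geometricRep_single_eq_smul cs exists_third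
    (commute_simple_mul_simple cs hcomm)
  have hdet : ∏ i, c i = 1 := by
    rw [← det_eq_prod_of_single_eq_smul hc, orbisphere_det_eq_one hord z, Units.val_one]
  have hinf : ∀ i j, M i j = 0 → c i ≤ 0 → c j ≤ 0 → False := by
    intro i j hij hi hj
    refine not_geometricRep_nonpos_of_eq_zero cs (w := w) hij ?_ ?_
    · rw [hc]
      exact smul_nonpos_of_nonpos_of_nonneg hi (Pi.single_nonneg.2 zero_le_one)
    · rw [hc]
      exact smul_nonpos_of_nonpos_of_nonneg hj (Pi.single_nonneg.2 zero_le_one)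
  have hinf' : ∀ i j, M i j = 0 → c i = c j := by
    intro i j hij
    apply hcc
    rw [coxeterGram, hij, gramEntry_zero]
    norm_num
  -- Once no root changes sign, `w = 1`. Two roots with entry `∞` have equal coefficients and cannot
  -- both become negative; this settles `N ≥ 1`, where sides `i` and `i + 2` are such a pair.
  have hpos : ∀ i, 0 ≤ c i := by
    intro i
    by_contra! hi
    rcases Nat.eq_zero_or_pos N with rfl | hN
    · have htwo : ∀ x, c x ≠ c (x + 1) → (ord x).toNat = 2 := by
        intro x hx
        have h0 : coxeterGram M x (x + 1) = 0 := by
          by_contra h0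
          exact hx (hcc _ _ h0)
        rw [coxeterGram, hM, orbisphereMatrix, polygonMatrix_succ] at h0
        apply eq_of_gramEntry_sq_eq (toNat_ne_one_of_two_le (hord x)) (by norm_num)
        rw [h0, gramEntry_two]
      have hcyc : ∀ x : Fin (0 + 3), x + 1 + 1 + 1 = x := by decide
      -- In a triangle, unequal neighbouring coefficients force a right angle. Two right angles give
      -- `(2, 2, ∞)`: the equal coefficients at the infinite vertex contribute a square to the
      -- determinant `1`, so the third is positive, and a negative coefficient would have to be
      -- theirs.
      have key : ∀ x, c x ≠ c (x + 1) → c (x + 1) ≠ c (x + 1 + 1) → False := by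
        intro x hx hx'
        have h1 := toNat_eq_zero_of_eq_two hχ (htwo _ hx) (htwo _ hx')
        have h2 : M (x + 1 + 1) x = 0 := by
          have := polygonMatrix_succ (fun i => (ord i).toNat)
            (fun i => toNat_ne_one_of_two_le (hord i)) (x + 1 + 1)
          rw [hcyc] at this
          exact this.trans h1
        have h3 := hinf' _ _ h2
        rw [prod_fin_zero_add_three c x, h3] at hdet
        have hpos : 0 < c (x + 1) := by
          by_contra! h
          nlinarith [mul_self_nonneg (c x)]
        have hneg : c x ≤ 0 := by
          rcases eq_or_eq_or_eq x i with rfl | rfl | rfl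
          · exact hi.le
          · linarith
          · rw [← h3]; exact hi.le
        exact hinf _ _ h2 (h3 ▸ hneg) hneg
      have k1 := key i
      have k2 := key (i + 1)
      have k3 := key (i + 1 + 1)
      rw [hcyc] at k2 k3
      rw [prod_fin_zero_add_three c i] at hdet
      by_cases e1 : c i = c (i + 1)
      · by_cases e2 : c (i + 1) = c (i + 1 + 1)
        -- All coefficients are equal and negative, so their product is negative and cannot be `1`.
        · rw [← e2, ← e1] at hdet
          nlinarith [mul_self_nonneg (c i)]
        · exact k2 e2 fun h => e2 (e1.symm.trans h.symm)
      · by_cases e2 : c (i + 1) = c (i + 1 + 1)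
        · exact k3 (fun h => e1 (h.symm.trans e2.symm)) e1
        · exact k1 e1 e2
    · have h1 : M i (i + 1 + 1) = 0 := polygonMatrix_add_two hN _ _ i
      exact hinf _ _ h1 hi.le (hinf' _ _ h1 ▸ hi.le)
  have hw1 : w = 1 := by
    apply eq_one_of_geometricRep_nonneg cs
    intro i
    rw [hc]
    exact smul_nonneg (hpos i) (Pi.single_nonneg.2 zero_le_one)
  exact orbisphereToCoxeter_injective ord hord (hw1.trans (map_one _).symm)

end Center

/-! ### Ree's inequality and centralizers of admissible tuples. -/

section Ree

open Module Equiv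

theorem finrank_add_finrank_range_le_of_comp_eq_zero {K : Type*} [Field K] {V W : Type*}
    [AddCommGroup V] [Module K V] [FiniteDimensional K V] [AddCommGroup W] [Module K W]
    (A : V →ₗ[K] W) [FiniteDimensional K W] (D : W →ₗ[K] V) (h : D ∘ₗ A = 0) :
    finrank K V + finrank K (LinearMap.range D) ≤
      finrank K W + finrank K (LinearMap.ker A) := by
  have h1 := A.finrank_range_add_finrank_ker
  have h2 := D.finrank_range_add_finrank_ker
  have h3 : LinearMap.range A ≤ LinearMap.ker D := by
    rintro _ ⟨v, rfl⟩
    exact LinearMap.congr_fun h v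
  have h4 := Submodule.finrank_mono h3
  omega

variable {Y : Type*}

theorem perm_apply_inv_apply (σ : Perm Y) (y : Y) : σ (σ⁻¹ y) = y := σ.apply_symm_apply y

theorem card_permCycles_le_finrank_ker [Finite Y] (σ : Perm Y) :
    Nat.card (PermCycles σ) ≤
      finrank ℚ (LinearMap.ker (LinearMap.funLeft ℚ ℚ σ - LinearMap.id)) := by
  classical
  have := Fintype.ofFinite (PermCycles σ)
  let L : (PermCycles σ → ℚ) →ₗ[ℚ] LinearMap.ker (LinearMap.funLeft ℚ ℚ σ - LinearMap.id) :=
    (LinearMap.funLeft ℚ ℚ (Quotient.mk (Perm.SameCycle.setoid σ))).codRestrict _ (by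
      intro f
      rw [LinearMap.mem_ker]
      ext y
      have : (Quotient.mk (Perm.SameCycle.setoid σ) (σ y)) = Quotient.mk _ y :=
        Quotient.sound (Perm.sameCycle_apply_left.2 (Perm.SameCycle.refl σ y))
      simp [LinearMap.funLeft_apply, this])
  have hL : Function.Injective L := by
    rw [LinearMap.injective_codRestrict_iff]
    exact LinearMap.funLeft_injective_of_surjective _ _ _ Quotient.mk_surjective
  have := LinearMap.finrank_le_finrank_of_injective hL
  rwa [finrank_fintype_fun_eq_card, ← Nat.card_eq_fintype_card] at this

/-- The product `σ (k - 1) ⋯ σ 0` of the first `k` permutations of a tuple. -/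
def prefixProd {n : ℕ} (σ : Fin n → Perm Y) (k : ℕ) : Perm Y :=
  ((List.ofFn σ).take k).reverse.prod

theorem prefixProd_zero {n : ℕ} (σ : Fin n → Perm Y) : prefixProd σ 0 = 1 := by
  simp [prefixProd]

theorem prefixProd_succ {n : ℕ} (σ : Fin n → Perm Y) (i : Fin n) :
    prefixProd σ (i + 1) = σ i * prefixProd σ i := by
  have h : (List.ofFn σ).take (i + 1) = (List.ofFn σ).take i ++ [σ i] := by
    rw [List.take_add_one, List.getElem?_eq_getElem (by simp)]
    simp
  rw [prefixProd, h, List.reverse_append, List.prod_append]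
  simp [prefixProd]

theorem prefixProd_last {n : ℕ} (σ : Fin n → Perm Y) :
    prefixProd σ n = (List.ofFn σ).reverse.prod := by
  rw [prefixProd, List.take_of_length_le (by simp)]

/-- Ree's inequality, the combinatorial form of the non-negativity of the genus. -/
theorem sum_card_permCycles_le [Finite Y] [Nonempty Y] {n : ℕ} (σ : Fin n → Perm Y)
    (hprod : (List.ofFn σ).reverse.prod = 1)
    (htrans : MulAction.IsPretransitive (Subgroup.closure (Set.range σ)) Y) :
    ∑ i, Nat.card (PermCycles (σ i)) + 2 * Nat.card Y ≤ n * Nat.card Y + 2 := by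
  classical
  have := Fintype.ofFinite Y
  -- Scott's linear argument: `A` sends `f` to all `f ∘ σ i - f`, and `D` adds these after twisting
  -- by prefixes. The sum telescopes to `f ∘ (product) - f = 0`, and dimensions are counted in `D ∘
  -- A = 0`.
  let U : Fin n → (Y → ℚ) →ₗ[ℚ] (Y → ℚ) := fun i => LinearMap.funLeft ℚ ℚ (σ i) - LinearMap.id
  let A : (Y → ℚ) →ₗ[ℚ] (∀ i, LinearMap.range (U i)) := LinearMap.pi fun i => (U i).rangeRestrict
  let D : (∀ i, LinearMap.range (U i)) →ₗ[ℚ] (Y → ℚ) :=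
    ∑ i : Fin n, LinearMap.funLeft ℚ ℚ (prefixProd σ i) ∘ₗ
      (LinearMap.range (U i)).subtype ∘ₗ LinearMap.proj i
  have hDA : D ∘ₗ A = 0 := by
    refine LinearMap.ext fun f => ?_
    ext y
    have h1 : (D ∘ₗ A) f y = ∑ i : Fin n, (f (prefixProd σ (i + 1) y) - f (prefixProd σ i y)) := by
      simp only [D, A, LinearMap.comp_apply, LinearMap.sum_apply, Finset.sum_apply,
        LinearMap.funLeft_apply, prefixProd_succ, Perm.mul_apply]
      rfl
    rw [h1, Fin.sum_univ_eq_sum_range (fun k => f (prefixProd σ (k + 1) y) - f (prefixProd σ k y)),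
      Finset.sum_range_sub (fun k => f (prefixProd σ k y)), prefixProd_last, hprod,
      prefixProd_zero]
    simp
  have hmain := finrank_add_finrank_range_le_of_comp_eq_zero A D hDA
  obtain ⟨y₀⟩ := ‹Nonempty Y›
  -- The kernel consists of invariant functions, constant by transitivity.
  have hker : finrank ℚ (LinearMap.ker A) ≤ 1 := by
    refine finrank_le_one (⟨fun _ => 1, ?_⟩ : LinearMap.ker A) fun v => ⟨v.1 y₀, ?_⟩
    · rw [LinearMap.mem_ker]
      ext i y
      simp [A, U, LinearMap.funLeft_apply]
    · ext y
      have hinv : ∀ i y, v.1 (σ i y) = v.1 y := by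
        intro i y
        have h1 := congrFun (congrArg Subtype.val (congrFun (LinearMap.mem_ker.1 v.2) i)) y
        exact sub_eq_zero.1 h1
      have hinv' : ∀ g ∈ Subgroup.closure (Set.range σ), ∀ y, v.1 (g y) = v.1 y := by
        intro g hg
        induction hg using Subgroup.closure_induction with
        | mem x hx => obtain ⟨i, rfl⟩ := hx; exact hinv i
        | one => intro y; rfl
        | mul a b _ _ ha hb => intro y; rw [Perm.mul_apply, ha, hb]
        | inv a _ ha => intro y; rw [← ha, perm_apply_inv_apply]
      obtain ⟨g, hg⟩ := htrans.exists_smul_eq y₀ y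
      have := hinv' g g.2 y₀
      rw [← hg]
      simp only [SetLike.val_smul, Pi.smul_apply, smul_eq_mul, mul_one]
      exact this.symm
  -- Modulo the range of `D` all point masses agree, by transitivity, so its codimension is at most
  -- one.
  have hrange : finrank ℚ (Y → ℚ) ≤ finrank ℚ (LinearMap.range D) + 1 := by
    set R := LinearMap.range D with hR
    have h1 : ∀ i v, LinearMap.funLeft ℚ ℚ (prefixProd σ (i : Fin n)) (U i v) ∈ R := by
      intro i v
      refine ⟨Pi.single i ⟨U i v, v, rfl⟩, ?_⟩
      simp only [D, LinearMap.sum_apply, LinearMap.comp_apply, LinearMap.proj_apply]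
      rw [Finset.sum_eq_single i]
      · simp
      · intro j _ hj
        simp [Pi.single_eq_of_ne hj]
      · simp
    -- Prefixes act trivially modulo `R`, so the twist in `h1` can be removed.
    have h2 : ∀ k ≤ n, ∀ v : Y → ℚ, LinearMap.funLeft ℚ ℚ (prefixProd σ k) v - v ∈ R := by
      intro k
      induction k with
      | zero =>
        intro _ v
        have : LinearMap.funLeft ℚ ℚ (prefixProd σ 0) v - v = 0 := by
          ext y
          simp [prefixProd_zero]
        rw [this]
        exact zero_mem _
      | succ k ih =>
        intro hk v
        have h3 := R.add_mem (ih (by omega) v) (h1 ⟨k, hk⟩ v)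
        convert h3 using 1
        ext y
        have := prefixProd_succ σ ⟨k, hk⟩
        simp only at this
        simp [U, LinearMap.funLeft_apply, this]
    have h3 : ∀ i v, U i v ∈ R := by
      intro i v
      have := R.sub_mem (h1 i v) (h2 i i.2.le (U i v))
      rwa [sub_sub_cancel] at this
    have h4 : ∀ i y, (Pi.single y 1 - Pi.single (σ i y) 1 : Y → ℚ) ∈ R := by
      intro i y
      convert h3 i (Pi.single (σ i y) 1) using 1
      ext x
      simp [U, LinearMap.funLeft_apply, Pi.single_apply]
    have h5 : ∀ g ∈ Subgroup.closure (Set.range σ), ∀ y,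
        (Pi.single y 1 - Pi.single (g y) 1 : Y → ℚ) ∈ R := by
      intro g hg
      induction hg using Subgroup.closure_induction with
      | mem x hx => obtain ⟨i, rfl⟩ := hx; exact h4 i
      | one => intro y; simp
      | mul a b _ _ ha hb =>
        intro y
        have := R.add_mem (hb y) (ha (b y))
        rwa [sub_add_sub_cancel] at this
      | inv a _ ha =>
        intro y
        have := R.neg_mem (ha (a⁻¹ y))
        rwa [neg_sub, perm_apply_inv_apply] at this
    have h6 : (⊤ : Submodule ℚ (Y → ℚ)) ≤ R ⊔ Submodule.span ℚ {Pi.single y₀ 1} := by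
      rw [← (Pi.basisFun ℚ Y).span_eq, Submodule.span_le]
      rintro _ ⟨y, rfl⟩
      obtain ⟨g, hg⟩ := htrans.exists_smul_eq y y₀
      have h7 := h5 g g.2 y
      rw [Pi.basisFun_apply]
      have h8 : (g : Perm Y) y = y₀ := hg
      rw [h8] at h7
      exact Submodule.mem_sup.2 ⟨_, h7, _, Submodule.mem_span_singleton_self _, by simp⟩
    calc finrank ℚ (Y → ℚ) = finrank ℚ (⊤ : Submodule ℚ (Y → ℚ)) := (finrank_top ℚ _).symm
      _ ≤ finrank ℚ (R ⊔ Submodule.span ℚ {Pi.single y₀ 1} : Submodule ℚ (Y → ℚ)) :=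
        Submodule.finrank_mono h6
      _ ≤ finrank ℚ R + finrank ℚ (Submodule.span ℚ {(Pi.single y₀ 1 : Y → ℚ)}) :=
        Submodule.finrank_add_le_finrank_add_finrank _ _
      _ ≤ finrank ℚ R + 1 := by
        gcongr
        exact (finrank_span_le_card _).trans (by simp)
  have hW : finrank ℚ (∀ i, LinearMap.range (U i)) = ∑ i, finrank ℚ (LinearMap.range (U i)) :=
    finrank_pi_fintype ℚ
  have hi : ∀ i, finrank ℚ (LinearMap.range (U i)) + Nat.card (PermCycles (σ i)) ≤ Nat.card Y := by
    intro i
    have h1 := (U i).finrank_range_add_finrank_ker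
    have h2 := card_permCycles_le_finrank_ker (σ i)
    rw [finrank_fintype_fun_eq_card, ← Nat.card_eq_fintype_card] at h1
    simp only [U] at *
    omega
  have hsum := Finset.sum_le_sum fun i (_ : i ∈ Finset.univ) => hi i
  rw [Finset.sum_add_distrib, Finset.sum_const, Finset.card_univ, Fintype.card_fin,
    smul_eq_mul] at hsum
  rw [finrank_fintype_fun_eq_card, ← Nat.card_eq_fintype_card] at hmain hrange
  omega

open scoped Classical in
-- The cycles map onto the fixed points together with the non-trivial cycle factors; this inequality
-- is the direction needed.
theorem card_le_card_permCycles_add [Fintype Y] (σ : Perm Y) :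
    Fintype.card Y ≤ Nat.card (PermCycles σ) + (σ.cycleType.map fun l => l - 1).sum := by
  let F : PermCycles σ → Function.fixedPoints σ ⊕ σ.cycleFactorsFinset :=
    Quotient.lift (fun x => if h : σ x = x then Sum.inl ⟨x, h⟩ else
      Sum.inr ⟨σ.cycleOf x, Perm.cycleOf_mem_cycleFactorsFinset_iff.2 (Perm.mem_support.2 h)⟩) (by
      intro x y hxy
      have hxy : σ.SameCycle x y := hxy
      by_cases h : σ x = x
      · have := hxy.choose_spec
        rw [Perm.zpow_apply_eq_self_of_apply_eq_self h] at this
        subst this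
        rfl
      · have h' : ¬ σ y = y := fun h' => h (hxy.apply_eq_self_iff.2 h')
        simp only [h, h', dif_neg, not_false_eq_true, hxy.cycleOf_eq])
  have hF : Function.Surjective F := by
    rintro (⟨x, hx⟩ | ⟨c, hc⟩)
    · exact ⟨Quotient.mk _ x, dif_pos hx⟩
    · have hc' := Perm.mem_cycleFactorsFinset_iff.1 hc
      obtain ⟨x, hx⟩ := hc'.1.nonempty_support
      have hx' : σ x ≠ x := by
        rw [← hc'.2 x hx]
        exact Perm.mem_support.1 hx
      refine ⟨Quotient.mk _ x, (dif_neg hx').trans ?_⟩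
      congr 2
      exact (Perm.cycle_is_cycleOf hx hc).symm
  have h1 := Nat.card_le_card_of_surjective F hF
  rw [Nat.card_sum, Nat.card_eq_fintype_card, Nat.card_eq_fintype_card,
    Fintype.card_coe, Perm.card_fixedPoints] at h1
  have h2 := σ.sum_cycleType
  have h3 : (σ.cycleType.map fun l => l - 1).sum + σ.cycleFactorsFinset.card =
      σ.cycleType.sum := by
    rw [Perm.cycleType_def, Multiset.map_map, ← Finset.sum_eq_multiset_sum,
      ← Finset.sum_eq_multiset_sum, Finset.card_eq_sum_ones, ← Finset.sum_add_distrib]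
    refine Finset.sum_congr rfl fun c hc => ?_
    have := (Perm.mem_cycleFactorsFinset_iff.1 hc).1.two_le_card_support
    simp only [Function.comp_apply]
    omega
  have h4 : σ.support.card ≤ Fintype.card Y := Finset.card_le_univ _
  omega

variable {X : Type*}

/-- Burnside's count: the identity fixes all of `C`, every other element at least `F`. -/
theorem card_add_le_card_orbits_mul {Z C : Type*} [Group Z] [Finite Z] [Finite C] [MulAction Z C]
    (F : Finset C) (hF : ∀ c ∈ F, ∀ z : Z, z • c = c) :
    Nat.card C + (Nat.card Z - 1) * F.card ≤
      Nat.card (MulAction.orbitRel.Quotient Z C) * Nat.card Z := by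
  classical
  have := Fintype.ofFinite Z
  have := Fintype.ofFinite C
  have := Fintype.ofFinite (MulAction.orbitRel.Quotient Z C)
  have h := MulAction.sum_card_fixedBy_eq_card_orbits_mul_card_group Z C
  rw [← Finset.add_sum_erase _ _ (Finset.mem_univ (1 : Z))] at h
  rw [Nat.card_eq_fintype_card (α := MulAction.orbitRel.Quotient Z C),
    Nat.card_eq_fintype_card (α := Z), Nat.card_eq_fintype_card (α := C)]
  rw [← h]
  apply add_le_add
  · refine Fintype.card_le_of_injective (fun c => ⟨c, by simp⟩) fun a b hab => ?_
    exact congrArg (fun x : MulAction.fixedBy C (1 : Z) => x.1) hab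
  · rw [← Finset.card_univ, ← Finset.card_erase_of_mem (Finset.mem_univ (1 : Z)), ← smul_eq_mul]
    refine Finset.card_nsmul_le_sum _ _ _ fun z _ => ?_
    rw [← Fintype.card_coe]
    exact Fintype.card_le_of_injective
      (fun c : F => (⟨c.1, hF c.1 c.2 z⟩ : MulAction.fixedBy C z))
      fun a b hab => Subtype.ext (congrArg (fun x : MulAction.fixedBy C z => x.1) hab)

theorem card_eq_card_orbits_mul {Z : Type*} [Group Z] [Finite Z] [Finite X] [MulAction Z X]
    (hfree : ∀ (z : Z) (x : X), z • x = x → z = 1) :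
    Nat.card X = Nat.card (MulAction.orbitRel.Quotient Z X) * Nat.card Z := by
  classical
  have := Fintype.ofFinite Z
  have := Fintype.ofFinite X
  have := Fintype.ofFinite (MulAction.orbitRel.Quotient Z X)
  have h := MulAction.sum_card_fixedBy_eq_card_orbits_mul_card_group Z X
  rw [Nat.card_eq_fintype_card, Nat.card_eq_fintype_card, Nat.card_eq_fintype_card, ← h,
    Finset.sum_eq_single 1]
  · refine Fintype.card_congr (Equiv.symm (Equiv.subtypeUnivEquiv fun x => ?_))
    simp
  · intro z _ hz
    rw [Fintype.card_eq_zero_iff]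
    exact ⟨fun x => hz (hfree z x.1 x.2)⟩
  · simp

/-- The centralizer of a transitive group acts freely. -/
theorem eq_one_of_apply_eq_self_of_commute {S : Set (Perm X)}
    (htrans : MulAction.IsPretransitive (Subgroup.closure S) X) {z : Perm X}
    (hz : ∀ s ∈ S, Commute z s) {x : X} (hx : z x = x) : z = 1 := by
  have h : ∀ g ∈ Subgroup.closure S, Commute z g := by
    intro g hg
    induction hg using Subgroup.closure_induction with
    | mem s hs => exact hz s hs
    | one => exact Commute.one_right z
    | mul a b _ _ ha hb => exact ha.mul_right hb
    | inv a _ ha => exact ha.inv_right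
  ext y
  obtain ⟨g, rfl⟩ := htrans.exists_smul_eq x y
  have := DFunLike.congr_fun (h g g.2).eq x
  simp only [Perm.mul_apply, hx] at this
  exact this

/-- The permutation of the orbits of `Z` induced by a permutation commuting with `Z`. -/
def orbitPerm (Z : Subgroup (Perm X)) (σ : Perm X) (h : ∀ z ∈ Z, Commute z σ) :
    Perm (MulAction.orbitRel.Quotient Z X) :=
  Quotient.congr σ (by
    intro a b
    change a ∈ MulAction.orbit Z b ↔ σ a ∈ MulAction.orbit Z (σ b)
    have hc : ∀ (z : Z) (x : X), z • σ x = σ (z • x) := fun z x =>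
      DFunLike.congr_fun (h z z.2).eq x
    constructor
    · rintro ⟨z, rfl⟩
      exact ⟨z, hc z b⟩
    · rintro ⟨z, hz⟩
      refine ⟨z, σ.injective ?_⟩
      rw [← hz]
      exact (hc z b).symm)

theorem list_prod_orbitPerm_mk (Z : Subgroup (Perm X)) {n : ℕ} (σ : Fin n → Perm X)
    (h : ∀ i, ∀ z ∈ Z, Commute z (σ i)) (l : List (Fin n)) (x : X) :
    (l.map fun i => orbitPerm Z (σ i) (h i)).prod (Quotient.mk _ x) =
      Quotient.mk _ ((l.map σ).prod x) := by
  induction l with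
  | nil => rfl
  | cons i l ih =>
    rw [List.map_cons, List.prod_cons, List.map_cons, List.prod_cons, Perm.mul_apply, ih]
    rfl

/-- The action on the cycles of `σ` of a group of permutations commuting with `σ`. -/
abbrev permCyclesAction (Z : Subgroup (Perm X)) (σ : Perm X) (h : ∀ z ∈ Z, Commute z σ) :
    MulAction Z (PermCycles σ) where
  smul z := Quotient.map z.1 (by
    rintro x y ⟨k, rfl⟩
    exact ⟨k, (DFunLike.congr_fun ((h z z.2).zpow_right k).eq x).symm⟩)
  one_smul := by rintro ⟨x⟩; rfl
  mul_smul := by rintro a b ⟨x⟩; rfl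

theorem card_orbits_permCycles_le [Finite X] (Z : Subgroup (Perm X)) (σ : Perm X)
    (h : ∀ z ∈ Z, Commute z σ) :
    letI := permCyclesAction Z σ h
    Nat.card (MulAction.orbitRel.Quotient Z (PermCycles σ)) ≤
      Nat.card (PermCycles (orbitPerm Z σ h)) := by
  let := permCyclesAction Z σ h
  let F : MulAction.orbitRel.Quotient Z X → MulAction.orbitRel.Quotient Z (PermCycles σ) :=
    Quotient.lift (fun x => Quotient.mk _ (Quotient.mk (Perm.SameCycle.setoid σ) x)) (by
      rintro a b ⟨z, rfl⟩
      exact Quotient.sound ⟨z, rfl⟩)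
  have hF : ∀ y, F (orbitPerm Z σ h y) = F y := by
    rintro ⟨x⟩
    have : (Quotient.mk (Perm.SameCycle.setoid σ) (σ x)) = Quotient.mk _ x :=
      Quotient.sound (Perm.sameCycle_apply_left.2 (Perm.SameCycle.refl σ x))
    exact congrArg (Quotient.mk _) this
  have hF' : ∀ (k : ℤ) y, F ((orbitPerm Z σ h ^ k) y) = F y := by
    intro k
    induction k with
    | zero => intro y; rfl
    | succ k ih => intro y; rw [add_comm, zpow_one_add, Perm.mul_apply, hF, ih]
    | pred k ih =>
      intro y
      rw [← ih y, sub_eq_add_neg, add_comm, zpow_add, zpow_neg_one, Perm.mul_apply,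
        ← hF, perm_apply_inv_apply]
  let F' : PermCycles (orbitPerm Z σ h) → MulAction.orbitRel.Quotient Z (PermCycles σ) :=
    Quotient.lift F (by
      rintro a b ⟨k, rfl⟩
      exact (hF' k a).symm)
  refine Nat.card_le_card_of_surjective F' ?_
  rintro ⟨⟨x⟩⟩
  exact ⟨Quotient.mk _ (Quotient.mk _ x), rfl⟩

/-- A permutation commuting with an admissible tuple and preserving three cycles is trivial. -/
theorem eq_one_of_commute_admissible [Fintype X] [Nonempty X] {n m : ℕ} {σ : Fin n → Perm X}
    (hσ : IsAdmissibleTuple σ) {τ : Perm X} (hτ : ∀ i, Commute τ (σ i)) (hm : 3 ≤ m)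
    (J : Fin m ↪ Σ i, PermCycles (σ i))
    (hJ : ∀ j x, Quotient.mk _ x = (J j).2 → Quotient.mk _ (τ x) = (J j).2) : τ = 1 := by
  classical
  set Z := Subgroup.zpowers τ with hZ
  have hZσ : ∀ i, ∀ z ∈ Z, Commute z (σ i) := by
    rintro i _ ⟨k, rfl⟩
    exact (hτ i).zpow_left k
  have hfree : ∀ (z : Z) (x : X), z • x = x → z = 1 := by
    intro z x hx
    refine Subtype.ext (eq_one_of_apply_eq_self_of_commute hσ.transitive (x := x) ?_ hx)
    rintro _ ⟨i, rfl⟩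
    exact hZσ i z z.2
  have hX := card_eq_card_orbits_mul hfree
  have : Nonempty (MulAction.orbitRel.Quotient Z X) :=
    ‹Nonempty X›.map (Quotient.mk (MulAction.orbitRel Z X))
  have hree := sum_card_permCycles_le (fun i => orbitPerm Z (σ i) (hZσ i))
    (by
      ext1 y
      obtain ⟨x, rfl⟩ := Quotient.exists_rep y
      have h1 := hσ.prod_eq_one
      rw [List.ofFn_eq_map, ← List.map_reverse] at h1 ⊢
      rw [list_prod_orbitPerm_mk, h1]
      rfl)
    (by
      have key : ∀ g ∈ Subgroup.closure (Set.range σ), ∀ x,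
          ∃ g' ∈ Subgroup.closure (Set.range fun i => orbitPerm Z (σ i) (hZσ i)),
            g' (Quotient.mk _ x) = Quotient.mk _ (g x) := by
        intro g hg
        induction hg using Subgroup.closure_induction with
        | mem s hs =>
          obtain ⟨i, rfl⟩ := hs
          exact fun x => ⟨_, Subgroup.subset_closure ⟨i, rfl⟩, rfl⟩
        | one => exact fun x => ⟨1, one_mem _, rfl⟩
        | mul a b _ _ ha hb =>
          intro x
          obtain ⟨b', hb1, hb2⟩ := hb x
          obtain ⟨a', ha1, ha2⟩ := ha (b x)
          exact ⟨a' * b', mul_mem ha1 hb1, by rw [Perm.mul_apply, hb2, ha2]; rfl⟩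
        | inv a _ ha =>
          intro x
          obtain ⟨a', ha1, ha2⟩ := ha (a⁻¹ x)
          refine ⟨a'⁻¹, inv_mem ha1, ?_⟩
          rw [Perm.inv_eq_iff_eq, ha2, perm_apply_inv_apply]
      constructor
      rintro ⟨x⟩ ⟨y⟩
      obtain ⟨g, rfl⟩ := hσ.transitive.exists_smul_eq x y
      obtain ⟨g', h1, h2⟩ := key g g.2 x
      exact ⟨⟨g', h1⟩, h2⟩)
  -- `F i` collects the marked cycles belonging to `σ i`; all are fixed by `Z`.
  set F : ∀ i, Finset (PermCycles (σ i)) := fun i =>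
    Finset.univ.filter fun c => (⟨i, c⟩ : Σ i, PermCycles (σ i)) ∈ Finset.univ.map J with hF
  have hFcard : ∑ i, (F i).card = m := by
    rw [← Finset.card_sigma]
    have : Finset.univ.sigma F = Finset.univ.map J := by
      ext ⟨i, c⟩
      simp [hF]
    rw [this, Finset.card_map, Finset.card_univ, Fintype.card_fin]
  have hcyc : ∀ i, Nat.card (PermCycles (σ i)) + (Nat.card Z - 1) * (F i).card ≤
      Nat.card (PermCycles (orbitPerm Z (σ i) (hZσ i))) * Nat.card Z := by
    intro i
    let := permCyclesAction Z (σ i) (hZσ i)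
    refine (card_add_le_card_orbits_mul (F i) ?_).trans
      (Nat.mul_le_mul_right _ (card_orbits_permCycles_le Z (σ i) (hZσ i)))
    intro c hc z
    simp only [hF, Finset.mem_filter, Finset.mem_univ, true_and, Finset.mem_map] at hc
    obtain ⟨j, hj⟩ := hc
    have hτc : (⟨τ, Subgroup.mem_zpowers τ⟩ : Z) • c = c := by
      obtain ⟨x, rfl⟩ := Quotient.exists_rep c
      have := hJ j
      rw [hj] at this
      exact this x rfl
    obtain ⟨z, k, rfl⟩ := z
    have : (⟨τ, Subgroup.mem_zpowers τ⟩ : Z) ^ k ∈ MulAction.stabilizer Z c :=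
      zpow_mem (MulAction.mem_stabilizer_iff.2 hτc) k
    exact this
  have hRH := hσ.riemann_hurwitz
  have hcard : ∀ i, Fintype.card X ≤ _ := fun i => card_le_card_permCycles_add (σ i)
  have h1 := Finset.sum_le_sum fun i (_ : i ∈ Finset.univ) => hcard i
  have h2 := Finset.sum_le_sum fun i (_ : i ∈ Finset.univ) => hcyc i
  rw [Finset.sum_add_distrib, Finset.sum_const, Finset.card_univ, Fintype.card_fin,
    smul_eq_mul] at h1
  rw [Finset.sum_add_distrib, ← Finset.mul_sum, hFcard, ← Finset.sum_mul] at h2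
  rw [Nat.card_eq_fintype_card (α := X)] at hX
  have hZpos : 0 < Nat.card Z := Nat.card_pos
  -- Let `z = |Z|` and let `d` be the number of `Z`-orbits. Riemann-Hurwitz gives at least `(n - 2)
  -- d z + 2` cycles upstairs, and Ree at most `(n - 2) d + 2` on the quotient. Burnside then yields
  -- `(z - 1) (m - 2) ≤ 0`, so `m ≥ 3` forces `z = 1`.
  have hZ1 : Nat.card Z = 1 := by
    generalize Nat.card Z = N at *
    generalize Nat.card (MulAction.orbitRel.Quotient Z X) = d at *
    obtain ⟨N, rfl⟩ : ∃ M, N = M + 1 := ⟨N - 1, by omega⟩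
    rw [Nat.add_sub_cancel] at h2
    rw [hX] at hRH h1
    have h3 := Nat.mul_le_mul_right (N + 1) hree
    have h4 : N * 3 ≤ N * m := Nat.mul_le_mul_left N hm
    have h5 : N = 0 := by
      by_contra h0
      have : 1 ≤ N := Nat.pos_of_ne_zero h0
      nlinarith
    omega
  have h := (Nat.card_eq_one_iff_unique.1 hZ1).1
  exact congrArg Subtype.val (h.elim (⟨τ, Subgroup.mem_zpowers τ⟩ : Z) 1)

end Ree

/-! ### Lifts along cycles of a left-free biset. -/

section Bisets

open Equiv

variable {H G B : Type*} [Group H] [Group G] [MulAction H B] [MulAction Gᵐᵒᵖ B]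
  [SMulCommClass H Gᵐᵒᵖ B]

theorem rightPerm_zpow_mk (g : G) (k : ℤ) (b : B) :
    (rightPerm (B := B) H g ^ k) (Quotient.mk _ b) = Quotient.mk _ (b <• (g ^ k)) := by
  induction k generalizing b with
  | zero => simp
  | succ k ih =>
    rw [zpow_add_one, Perm.mul_apply, rightPerm_mk, ih, smul_smul, ← MulOpposite.op_mul,
      ← zpow_one_add, add_comm]
  | pred k ih =>
    have h : (rightPerm (B := B) H g)⁻¹ (Quotient.mk _ b) = Quotient.mk _ (b <• g⁻¹) := by
      rw [Perm.inv_eq_iff_eq, rightPerm_mk, smul_smul, ← MulOpposite.op_mul, inv_mul_cancel,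
        MulOpposite.op_one, one_smul]
    rw [sub_eq_add_neg, zpow_add, zpow_neg_one, Perm.mul_apply, h, ih, smul_smul,
      ← MulOpposite.op_mul, ← zpow_neg_one, ← zpow_add, add_comm]

theorem minimalPeriod_apply_of_commute {X : Type*} {σ e : Perm X} (h : Commute e σ) (x : X) :
    Function.minimalPeriod σ (e x) = Function.minimalPeriod σ x := by
  rw [Function.minimalPeriod_eq_minimalPeriod_iff]
  intro n
  have h1 : σ^[n] (e x) = e (σ^[n] x) := by
    rw [Perm.iterate_eq_pow]
    exact (DFunLike.congr_fun (h.pow_right n).eq x).symm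
  rw [Function.IsPeriodicPt, Function.IsPeriodicPt, Function.IsFixedPt, Function.IsFixedPt, h1,
    e.apply_eq_iff_eq]

/-- Two representatives differ by a power of `g` and a left factor `t`. The power does not change
the lifting element, the factor conjugates it by `t`, and left freeness makes it unique. -/
theorem IsLift.unique (hfree : ∀ (h : H) (b : B), h • b = b → h = 1) {g : G}
    {c : PermCycles (rightPerm (B := B) H g)} {d d' : ℕ} {C C' : ConjClasses H}
    (h : IsLift g c d C) (h' : IsLift g c d' C') : C = C' := by
  obtain ⟨s, a, hs, hd, ha, rfl⟩ := h
  obtain ⟨s', a', hs', hd', ha', rfl⟩ := h'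
  obtain ⟨k, hk⟩ : (rightPerm (B := B) H g).SameCycle (Quotient.mk _ s) (Quotient.mk _ s') :=
    Quotient.exact (hs.trans hs'.symm)
  have hdd : d' = d := by
    rw [hd, hd', ← hk]
    exact minimalPeriod_apply_of_commute ((Commute.refl _).zpow_left k) _
  rw [rightPerm_zpow_mk] at hk
  obtain ⟨t, ht⟩ := Quotient.exact hk.symm
  have ht : t • (s <• (g ^ k)) = s' := ht
  rw [hdd] at ha'
  have e1 : (a' * t) • (s <• (g ^ k)) = (t * a) • (s <• (g ^ k)) := by
    rw [mul_smul, ht, ha', ← ht, mul_smul, smul_comm a, ha, ← smul_comm t, smul_smul, smul_smul,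
      ← MulOpposite.op_mul, ← MulOpposite.op_mul, ← zpow_natCast, ← zpow_add, ← zpow_add, add_comm]
  have e2 : a' * t = t * a := by
    have := hfree ((t * a)⁻¹ * (a' * t)) (s <• (g ^ k)) (by rw [mul_smul, e1, inv_smul_smul])
    exact (inv_mul_eq_one.1 this).symm
  rw [ConjClasses.mk_eq_mk_iff_isConj, isConj_iff]
  exact ⟨t, by rw [← e2, mul_inv_cancel_right]⟩

end Bisets

/-! ### Automorphisms of orbisphere bisets. -/

section Automorphisms

open Equiv

variable {G B : Type*} [Group G] [MulAction G B] [MulAction Gᵐᵒᵖ B] [SMulCommClass G Gᵐᵒᵖ B]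

omit [SMulCommClass G Gᵐᵒᵖ B] in
theorem bisetAut_apply_smul {β : Perm B} (hβ : β ∈ bisetAut G B) (h : G) (b : B) :
    β (h • b) = h • β b := by
  have : β (h • b <• (1 : G)) = h • β b <• (1 : G) := hβ h b 1
  simpa using this

omit [SMulCommClass G Gᵐᵒᵖ B] in
theorem bisetAut_apply_op_smul {β : Perm B} (hβ : β ∈ bisetAut G B) (b : B) (g : G) :
    β (b <• g) = β b <• g := by
  have : β ((1 : G) • b <• g) = (1 : G) • β b <• g := hβ 1 b g
  simpa using this

/-- The permutation of the left orbits induced by a biset automorphism. -/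
def leftOrbitsPerm (β : bisetAut G B) : Perm (LeftOrbits G B) :=
  Quotient.congr β.1 (by
    intro a b
    change a ∈ MulAction.orbit G b ↔ β.1 a ∈ MulAction.orbit G (β.1 b)
    constructor
    · rintro ⟨h, rfl⟩
      exact ⟨h, (bisetAut_apply_smul β.2 h b).symm⟩
    · rintro ⟨h, hh⟩
      exact ⟨h, β.1.injective ((bisetAut_apply_smul β.2 h b).trans hh)⟩)

omit [SMulCommClass G Gᵐᵒᵖ B] in
theorem leftOrbitsPerm_mk (β : bisetAut G B) (b : B) :
    leftOrbitsPerm β (Quotient.mk _ b) = Quotient.mk _ (β.1 b) := rfl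

theorem leftOrbitsPerm_commute (β : bisetAut G B) (g : G) :
    Commute (leftOrbitsPerm β) (rightPerm (B := B) G g) := by
  ext1 x
  obtain ⟨b, rfl⟩ := Quotient.exists_rep x
  rw [Perm.mul_apply, Perm.mul_apply, rightPerm_mk, leftOrbitsPerm_mk, leftOrbitsPerm_mk,
    rightPerm_mk, bisetAut_apply_op_smul β.2]

/-- Applying `β` to `h • s = s <• (g ^ d)` keeps `h` and `d`. -/
theorem IsLift.leftOrbitsPerm (β : bisetAut G B) {g : G} {x : LeftOrbits G B} {d : ℕ}
    {C : ConjClasses G} (h : IsLift (H := G) (B := B) g (Quotient.mk _ x) d C) :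
    IsLift (H := G) (B := B) g (Quotient.mk _ (leftOrbitsPerm β x)) d C := by
  obtain ⟨s, a, hs, hd, ha, rfl⟩ := h
  refine ⟨β.1 s, a, ?_, ?_, ?_, rfl⟩
  · obtain ⟨k, hk⟩ : (rightPerm (B := B) G g).SameCycle (Quotient.mk _ s) x := Quotient.exact hs
    refine Quotient.sound (s := Perm.SameCycle.setoid _) ⟨k, ?_⟩
    rw [← hk, ← leftOrbitsPerm_mk]
    exact (DFunLike.congr_fun ((leftOrbitsPerm_commute β g).zpow_right k).eq _).symm
  · rw [← leftOrbitsPerm_mk, minimalPeriod_apply_of_commute (leftOrbitsPerm_commute β g)]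
    exact hd
  · rw [← bisetAut_apply_smul β.2, ha, bisetAut_apply_op_smul β.2]

variable {n : ℕ} {Γ : Fin n → ConjClasses G}

/-- A biset automorphism fixes every left orbit if there are at least three peripheral classes,
all distinct and non-trivial. -/
theorem IsOrbisphereBiset.leftOrbitsPerm_eq_one (hB : IsOrbisphereBiset G G B Γ Γ) (hn : 3 ≤ n)
    (hinj : Function.Injective Γ) (hne : ∀ i, Γ i ≠ ConjClasses.mk 1) (β : bisetAut G B) :
    leftOrbitsPerm β = 1 := by
  obtain ⟨γ, -, hadm, ι, hι, hι'⟩ := hB.admissible_and_lifts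
  have := hB.finite_degree
  have hne' : Nonempty (LeftOrbits G B) := hB.nonempty.map (Quotient.mk _)
  let := Fintype.ofFinite (LeftOrbits G B)
  refine eq_one_of_commute_admissible hadm (fun i => leftOrbitsPerm_commute β (γ i)) hn ι ?_
  intro j x hx
  obtain ⟨d, hd⟩ := hι j
  rw [← hx] at hd
  have hd' := IsLift.leftOrbitsPerm β hd
  set c : Σ i, PermCycles (rightPerm (B := B) G (γ i)) :=
    ⟨(ι j).1, Quotient.mk _ (leftOrbitsPerm β x)⟩ with hc
  -- The image cycle still lifts to `Γ j`. If marked, it is `ι j` because the classes are distinct;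
  -- if unmarked, its lift would be trivial.
  by_cases hr : c ∈ Set.range ι
  · obtain ⟨k, hk⟩ := hr
    obtain ⟨d', hk'⟩ := hι k
    rw [hk] at hk'
    have hjk : j = k := hinj (hd'.unique hB.left_free hk')
    subst hjk
    rw [hc] at hk
    generalize ι j = p at *
    obtain ⟨i, q⟩ := p
    exact (eq_of_heq (Sigma.mk.inj hk).2).symm
  · obtain ⟨d', hc'⟩ := hι' c hr
    exact absurd (hd'.unique hB.left_free hc') (hne j)

theorem IsOrbisphereBiset.bisetAut_eq_bot (hB : IsOrbisphereBiset G G B Γ Γ) (hn : 3 ≤ n)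
    (hinj : Function.Injective Γ) (hne : ∀ i, Γ i ≠ ConjClasses.mk 1)
    (hcenter : ∀ z : G, (∀ g, Commute z g) → z = 1) : bisetAut G B = ⊥ := by
  rw [eq_bot_iff]
  intro β hβ
  rw [Subgroup.mem_bot]
  have h1 := hB.leftOrbitsPerm_eq_one hn hinj hne ⟨β, hβ⟩
  obtain ⟨b⟩ := hB.nonempty
  have h2 : (Quotient.mk _ (β b) : LeftOrbits G B) = Quotient.mk _ b := by
    rw [← leftOrbitsPerm_mk ⟨β, hβ⟩, h1]
    rfl
  obtain ⟨z, hz⟩ := Quotient.exact h2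
  have hz : z • b = β b := hz
  have hz1 : z = 1 := by
    refine hcenter z fun g => ?_
    -- Writing `g • b` as `b <• x` lets `β` be evaluated through either action; comparison gives `g
    -- * z = z * g` by left freeness.
    obtain ⟨x, hx⟩ := hB.right_transitive b (g • b)
    have e1 : (g * z) • b = (z * g) • b := by
      rw [mul_smul, hz, ← bisetAut_apply_smul hβ, ← hx, bisetAut_apply_op_smul hβ, ← hz,
        ← smul_comm, hx, mul_smul]
    have e2 := hB.left_free ((z * g)⁻¹ * (g * z)) b (by rw [mul_smul, e1, inv_smul_smul])
    exact inv_mul_eq_one.1 e2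
  rw [hz1, one_smul] at hz
  ext b'
  obtain ⟨x, rfl⟩ := hB.right_transitive b b'
  rw [bisetAut_apply_op_smul hβ, ← hz]
  rfl

omit [SMulCommClass G Gᵐᵒᵖ B] in
theorem IsSelfConjugacy.eq_of_bisetAut_eq_bot (h : bisetAut G B = ⊥) {φ : G ≃* G} {β β' : Perm B}
    (hβ : IsSelfConjugacy φ β) (hβ' : IsSelfConjugacy φ β') : β = β' := by
  have h1 : β'⁻¹ * β ∈ bisetAut G B := by
    intro g b g'
    apply β'.injective
    change β' (β'⁻¹ (β (g • b <• g'))) = β' (g • β'⁻¹ (β b) <• g')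
    rw [hβ', perm_apply_inv_apply, perm_apply_inv_apply, hβ]
  rw [h, Subgroup.mem_bot, inv_mul_eq_one] at h1
  exact h1.symm

end Automorphisms

/-- For two generators the relation makes them inverse to each other; non-cyclicity of `G` thus
supplies the third peripheral class. -/
theorem IsOrbisphereGroup.isCyclic {G : Type*} [Group G] {ord : Fin 2 → ℕ∞}
    {Γ : Fin 2 → ConjClasses G} (hG : IsOrbisphereGroup G ord Γ) : IsCyclic G := by
  obtain ⟨e, -⟩ := hG.presentation
  have h := orbisphereRels_prod ord
  simp only [List.ofFn_succ, List.ofFn_zero, List.prod_cons, List.prod_nil, mul_one] at h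
  have h1 : (PresentedGroup.of 1 : PresentedGroup (orbisphereRels ord)) =
      (PresentedGroup.of 0)⁻¹ := eq_inv_of_mul_eq_one_right h
  have hc : IsCyclic (PresentedGroup (orbisphereRels ord)) := by
    refine ⟨PresentedGroup.of 0, fun x => ?_⟩
    refine PresentedGroup.generated_by _ (Subgroup.zpowers (PresentedGroup.of 0)) ?_ x
    intro j
    fin_cases j
    · exact Subgroup.mem_zpowers _
    · have := inv_mem (Subgroup.mem_zpowers
        (PresentedGroup.of 0 : PresentedGroup (orbisphereRels ord)))
      rwa [← h1] at this
  exact e.isCyclic.1 hc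

theorem mainTheorem10 {G B : Type*} [Group G] [MulAction G B] [MulAction Gᵐᵒᵖ B]
    [SMulCommClass G Gᵐᵒᵖ B] {n : ℕ} (ord : Fin n → ℕ∞) (Γ : Fin n → ConjClasses G)
    (hG : IsOrbisphereGroup G ord Γ) (hχ : orbisphereEulerChar ord ≤ 0)
    (hcyc : ¬ IsCyclic G) (hB : IsOrbisphereBiset G G B Γ Γ) :
    bisetAut G B = ⊥ ∧
      ∀ (φ : G ≃* G) (β β' : Equiv.Perm B),
        IsSelfConjugacy φ β → IsSelfConjugacy φ β' → β = β' := by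
  suffices h : bisetAut G B = ⊥ from
    ⟨h, fun φ β β' hβ hβ' => hβ.eq_of_bisetAut_eq_bot h hβ'⟩
  have hn := hG.two_le_card
  obtain rfl | ⟨N, rfl⟩ : n = 2 ∨ ∃ N, n = N + 3 := by
    rcases Nat.lt_or_ge n 3 with h | h
    · exact Or.inl (by omega)
    · exact Or.inr ⟨n - 3, by omega⟩
  · exact absurd hG.isCyclic hcyc
  obtain ⟨e, he⟩ := hG.presentation
  refine hB.bisetAut_eq_bot (by omega) ?_ ?_ ?_
  · intro i j hij
    rw [← he, ← he, ConjClasses.mk_eq_mk_iff_isConj] at hij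
    have h1 := MonoidHom.map_isConj e.symm.toMonoidHom hij
    simp only [MulEquiv.toMonoidHom_eq_coe, MonoidHom.coe_coe, MulEquiv.symm_apply_apply] at h1
    exact orbisphere_eq_of_isConj hG.two_le_ord hχ h1
  · intro i h
    rw [← he, ConjClasses.mk_eq_mk_iff_isConj, isConj_one_left, MulEquiv.map_eq_one_iff] at h
    exact orbisphere_of_ne_one hG.two_le_ord i h
  · intro z hz
    rw [← MulEquiv.map_eq_one_iff e.symm]
    refine orbisphere_eq_one_of_commute hG.two_le_ord hχ fun g => ?_
    have := (hz (e g)).map e.symm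
    rwa [MulEquiv.symm_apply_apply] at this
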